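/- Let $\Gamma=(V,E)$ be a finite directed graph with $m\ge 1$ vertices, without multiple edges (loops allowed) and without sinks (every vertex is the source of an edge), with vertex matrix $D\in\{0,1\}^{V\times V}$, and write $s,t:E\to V$ for the source and target maps. Let $\mathrm{Aut}(\Gamma)$ be the group of permutations of $V$ preserving the edge relation in both directions, and assume that $\Gamma$ is circulant, i.e. $\mathrm{Aut}(\Gamma)$ contains an element that permutes the $m$ vertices in one $m$-cycle. Let $C^*(\Gamma)$ be the graph $C^*$-algebra: the universal $C^*$-algebra generated by mutually orthogonal projections $p_v$ $(v\in V)$ and partial isometries $S_e$ $(e\in E)$ with $S_e^*S_e=p_{t(e)}$ and $\sum_{s(e)=v}S_eS_e^*=p_v$; its unit is $\sum_v p_v$. It carries the dynamics $\sigma_r$ $(r\in\mathbb R)$ with $\sigma_r(p_v)=p_v$, $\sigma_r(S_e)=e^{ir}S_e$. For $\beta\in\mathbb R$, a $\mathrm{KMS}_\beta$ state is a $\sigma$-invariant state $\tau$ with $\tau(ab)=\tau(b\,\sigma_{i\beta}(a))$ for all $b$ and all entire analytic elements $a$ (invariance is automatic if $\beta\neq0$; so a $\mathrm{KMS}_0$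 state is a $\sigma$-invariant tracial state); a KMS state is a $\mathrm{KMS}_\beta$ state for some $\beta\in\mathbb R$. The group $\mathrm{Aut}(\Gamma)$ acts on $C^*(\Gamma)$ by $p_v\mapsto p_{g(v)}$, $S_{(v,w)}\mapsto S_{(g(v),g(w))}$. Then all row sums of $D$ equal one positive integer $\lambda$, which is the spectral radius of $D$, and there is exactly one $\mathrm{Aut}(\Gamma)$-invariant KMS state $\tau$ on $C^*(\Gamma)$. It is a $\mathrm{KMS}_\beta$ state for $\beta=\ln\lambda$ (the critical inverse temperature) and for no other $\beta$, and $\tau(p_v)=\frac1m$ for all $v\in V$; it is the only KMS state with these values on the vertex projections. Moreover $\tau$ is invariant under the quantum automorphism group of $\Gamma$. That is, let $Q^{\mathrm{aut}}_{\mathrm{Ban}}(\Gamma)$ be the universal unital $C^*$-algebra generated by projections $u_{vw}$ $(v,w\in V)$ with $\sum_w u_{vw}=\sum_w u_{wv}=1$ for all $v$ and $AD=DA$, where $A=(u_{vw})$; then there is a unital $*$-homomorphism $\alpha:C^*(\Gamma)\to C^*(\Gamma)\otimes_{\min}Q^{\mathrm{aut}}_{\mathrm{Ban}}(\Gamma)$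 with $$\alpha(p_v)=\sum_{k\in V}p_k\otimes u_{kv},\qquad \alpha(S_e)=\sum_{l\in E}S_l\otimes u_{s(l)s(e)}u_{t(l)t(e)},$$ and $(\tau\otimes\mathrm{id})(\alpha(a))=\tau(a)1$ for all $a\in C^*(\Gamma)$. -/

import Mathlib

open scoped ComplexOrder TensorProduct InnerProductSpace

noncomputable section

universe u v

/-! ### C*-seminorms on complex *-algebras and C*-completions -/

/-- A C*-seminorm on a unital complex *-algebra. -/
structure CStarSeminorm (F : Type u) [Ring F] [StarRing F] [Algebra ℂ F] extends
    Seminorm ℂ F where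
  mul_le' : ∀ a b : F, toFun (a * b) ≤ toFun a * toFun b
  star_mul_self' : ∀ a : F, toFun (star a * a) = toFun a ^ 2

namespace CStarSeminorm

section Basic

variable {F : Type u} [Ring F] [StarRing F] [Algebra ℂ F]

instance : CoeFun (CStarSeminorm F) (fun _ => F → ℝ) := ⟨fun q => q.toSeminorm⟩

variable (q : CStarSeminorm F)

theorem mul_le (a b : F) : q (a * b) ≤ q a * q b := q.mul_le' a b

theorem star_mul_self (a : F) : q (star a * a) = q a ^ 2 := q.star_mul_self' a

theorem nonneg (a : F) : 0 ≤ q a := apply_nonneg q.toSeminorm a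

theorem map_star (a : F) : q (star a) = q a := by
  have key : ∀ b : F, q b ≤ q (star b) := by
    intro b
    have h1 := q.star_mul_self b
    have h2 := q.mul_le (star b) b
    by_contra hlt
    push Not at hlt
    have h3 := q.nonneg (star b)
    nlinarith
  refine le_antisymm ?_ (key a)
  simpa using key (star a)

theorem map_one_le : q (1 : F) ≤ 1 := by
  have h1 := q.star_mul_self (1 : F)
  simp only [star_one, mul_one] at h1
  nlinarith [q.nonneg (1 : F)]

theorem eq_of_sub {a b : F} (h : q (a - b) = 0) : q a = q b := by
  have h1 : |q a - q b| ≤ q (a - b) := abs_sub_map_le_sub q.toSeminorm a b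
  rw [h] at h1
  have := abs_nonpos_iff.mp h1
  linarith

/-- The C*-seminorm obtained from a *-homomorphism into a C*-algebra. -/
def ofHom {B : Type v} [CStarAlgebra B] (π : F →⋆ₐ[ℂ] B) : CStarSeminorm F where
  toSeminorm := Seminorm.of (fun a => ‖π a‖) (fun a b => by simpa using norm_add_le _ _)
    (fun c a => by simp [norm_smul])
  mul_le' a b := by
    change ‖π (a * b)‖ ≤ ‖π a‖ * ‖π b‖
    simpa using norm_mul_le _ _
  star_mul_self' a := by
    change ‖π (star a * a)‖ = ‖π a‖ ^ 2
    rw [_root_.map_mul, StarHomClass.map_star, CStarRing.norm_star_mul_self, sq]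

theorem ofHom_apply {B : Type v} [CStarAlgebra B] (π : F →⋆ₐ[ℂ] B) (a : F) :
    ofHom π a = ‖π a‖ := rfl

/-- The pointwise supremum of a pointwise bounded family of C*-seminorms. -/
def sup {ι : Type v} (q : ι → CStarSeminorm F)
    (hb : ∀ a, BddAbove (Set.range fun i => q i a)) : CStarSeminorm F where
  toSeminorm := Seminorm.of (fun a => ⨆ i, q i a)
    (fun a b => by
      refine Real.iSup_le (fun i => ?_)
        (add_nonneg (Real.iSup_nonneg fun i => (q i).nonneg a)
          (Real.iSup_nonneg fun i => (q i).nonneg b))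
      exact (map_add_le_add (q i).toSeminorm a b).trans
        (add_le_add (le_ciSup (hb a) i) (le_ciSup (hb b) i)))
    (fun c a => by
      rw [Real.mul_iSup_of_nonneg (norm_nonneg c)]
      exact iSup_congr fun i => map_smul_eq_mul (q i).toSeminorm c a)
  mul_le' a b := by
    change (⨆ i, q i (a * b)) ≤ (⨆ i, q i a) * (⨆ i, q i b)
    have ha := Real.iSup_nonneg fun i => (q i).nonneg a
    have hb' := Real.iSup_nonneg fun i => (q i).nonneg b
    refine Real.iSup_le (fun i => ?_) (mul_nonneg ha hb')
    exact ((q i).mul_le a b).trans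
      (mul_le_mul (le_ciSup (hb a) i) (le_ciSup (hb b) i) ((q i).nonneg b) ha)
  star_mul_self' a := by
    change (⨆ i, q i (star a * a)) = (⨆ i, q i a) ^ 2
    have ha := Real.iSup_nonneg fun i => (q i).nonneg a
    have ha' := Real.iSup_nonneg fun i => (q i).nonneg (star a * a)
    apply le_antisymm
    · refine Real.iSup_le (fun i => ?_) (by positivity)
      rw [(q i).star_mul_self]
      exact pow_le_pow_left₀ ((q i).nonneg a) (le_ciSup (hb a) i) 2
    · have : (⨆ i, q i a) ≤ √(⨆ i, q i (star a * a)) := by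
        refine Real.iSup_le (fun i => ?_) (Real.sqrt_nonneg _)
        apply Real.le_sqrt_of_sq_le
        rw [← (q i).star_mul_self]
        exact le_ciSup (hb (star a * a)) i
      calc (⨆ i, q i a) ^ 2 ≤ (√(⨆ i, q i (star a * a))) ^ 2 := pow_le_pow_left₀ ha this 2
        _ = _ := Real.sq_sqrt ha'

theorem sup_apply {ι : Type v} (q : ι → CStarSeminorm F)
    (hb : ∀ a, BddAbove (Set.range fun i => q i a)) (a : F) :
    sup q hb a = ⨆ i, q i a := rfl

theorem le_sup {ι : Type v} (q : ι → CStarSeminorm F)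
    (hb : ∀ a, BddAbove (Set.range fun i => q i a)) (i : ι) (a : F) :
    q i a ≤ sup q hb a := le_ciSup (hb a) i

end Basic

section Completion

variable {F : Type u} [Ring F] [StarRing F] [Algebra ℂ F]

/-- The *-algebra `F`, topologized by the C*-seminorm `q`. -/
def Pre (_q : CStarSeminorm F) : Type u := F

variable (q : CStarSeminorm F)

instance : SeminormedRing q.Pre :=
  { (inferInstance : Ring F),
    (AddGroupSeminorm.toSeminormedAddCommGroup (E := F) q.toSeminorm.toAddGroupSeminorm) with
    norm_mul_le := fun a b => q.mul_le a b }

instance : StarRing q.Pre := inferInstanceAs (StarRing F)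

instance : NormedAlgebra ℂ q.Pre :=
  { (inferInstance : Algebra ℂ F) with
    norm_smul_le := fun c a => (map_smul_eq_mul q.toSeminorm c a).le }

instance [StarModule ℂ F] : StarModule ℂ q.Pre := inferInstanceAs (StarModule ℂ F)

instance : NormedStarGroup q.Pre where
  norm_star_le a := (q.map_star a).le

theorem norm_star_mul_self_pre (a : q.Pre) : ‖star a * a‖ = ‖a‖ ^ 2 := q.star_mul_self a

open UniformSpace

instance : Star (UniformSpace.Completion q.Pre) where
  star := UniformSpace.Completion.map (star : q.Pre → q.Pre)

theorem uniformContinuous_star_pre : UniformContinuous (star : q.Pre → q.Pre) :=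
  (starNormedAddGroupHom (E := q.Pre)).uniformContinuous

theorem coe_star_pre (a : q.Pre) :
    ((star a : q.Pre) : UniformSpace.Completion q.Pre) = star (a : UniformSpace.Completion q.Pre) :=
  (UniformSpace.Completion.map_coe q.uniformContinuous_star_pre a).symm

instance : ContinuousStar (UniformSpace.Completion q.Pre) where
  continuous_star := UniformSpace.Completion.continuous_map

instance : StarRing (UniformSpace.Completion q.Pre) where
  star_involutive x := by
    induction x using UniformSpace.Completion.induction_on with
    | hp => exact isClosed_eq (continuous_star.comp continuous_star) continuous_id
    | ih a => rw [← coe_star_pre, ← coe_star_pre, star_star]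
  star_mul x y := by
    induction x, y using UniformSpace.Completion.induction_on₂ with
    | hp => apply isClosed_eq <;> fun_prop
    | ih a b =>
      rw [← UniformSpace.Completion.coe_mul, ← coe_star_pre, ← coe_star_pre, ← coe_star_pre,
        ← UniformSpace.Completion.coe_mul, star_mul]
  star_add x y := by
    induction x, y using UniformSpace.Completion.induction_on₂ with
    | hp => apply isClosed_eq <;> fun_prop
    | ih a b =>
      rw [← UniformSpace.Completion.coe_add, ← coe_star_pre, ← coe_star_pre, ← coe_star_pre,
        ← UniformSpace.Completion.coe_add, star_add]

instance : CStarRing (UniformSpace.Completion q.Pre) where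
  norm_mul_self_le x := by
    induction x using UniformSpace.Completion.induction_on with
    | hp => apply isClosed_le <;> fun_prop
    | ih a =>
      rw [← coe_star_pre, ← UniformSpace.Completion.coe_mul, UniformSpace.Completion.norm_coe,
        UniformSpace.Completion.norm_coe, norm_star_mul_self_pre, sq]

instance : NormedAlgebra ℂ (UniformSpace.Completion q.Pre) where
  norm_smul_le := norm_smul_le

instance [StarModule ℂ F] : StarModule ℂ (UniformSpace.Completion q.Pre) where
  star_smul c x := by
    induction x using UniformSpace.Completion.induction_on with
    | hp =>
      exact isClosed_eq (continuous_star.comp (continuous_const_smul c))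
        ((continuous_const_smul (star c)).comp continuous_star)
    | ih a =>
      rw [← UniformSpace.Completion.coe_smul, ← coe_star_pre, ← coe_star_pre,
        ← UniformSpace.Completion.coe_smul, star_smul]

/-- The C*-algebra obtained from the *-algebra `F` and a C*-seminorm `q` on it: the Hausdorff
completion of `F` with respect to `q`. -/
def Completion : Type u := UniformSpace.Completion q.Pre

variable [StarModule ℂ F]

instance : CStarAlgebra (UniformSpace.Completion q.Pre) where

instance : CStarAlgebra q.Completion :=
  inferInstanceAs (CStarAlgebra (UniformSpace.Completion q.Pre))

instance : PartialOrder q.Completion := CStarAlgebra.spectralOrder _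

instance : StarOrderedRing q.Completion := CStarAlgebra.spectralOrderedRing _

/-- The canonical *-homomorphism from `F` to its C*-completion. -/
def toCompletion : F →⋆ₐ[ℂ] q.Completion where
  toFun a := ((show q.Pre from a) : UniformSpace.Completion q.Pre)
  map_one' := UniformSpace.Completion.coe_one q.Pre
  map_mul' a b := UniformSpace.Completion.coe_mul (α := q.Pre) a b
  map_zero' := UniformSpace.Completion.coe_zero (α := q.Pre)
  map_add' a b := UniformSpace.Completion.coe_add (α := q.Pre) a b
  commutes' _ := rfl
  map_star' a := q.coe_star_pre a

theorem norm_toCompletion (a : F) : ‖q.toCompletion a‖ = q a :=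
  UniformSpace.Completion.norm_coe (E := q.Pre) a

theorem denseRange_toCompletion : DenseRange q.toCompletion :=
  UniformSpace.Completion.denseRange_coe (α := q.Pre)

variable {B : Type v} [CStarAlgebra B]

/-- A *-homomorphism into a C*-algebra dominated by `q`, as a continuous linear map. -/
def preCLM (π : F →⋆ₐ[ℂ] B) (h : ∀ a, ‖π a‖ ≤ q a) : q.Pre →L[ℂ] B :=
  LinearMap.mkContinuous
    { toFun := fun a : q.Pre => π (show F from a)
      map_add' := fun a b => _root_.map_add π (show F from a) (show F from b)
      map_smul' := fun c a => _root_.map_smul π c (show F from a) } 1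
    (fun a => by rw [one_mul]; exact h a)

/-- The extension to the C*-completion of a *-homomorphism dominated by `q`. -/
def lift (π : F →⋆ₐ[ℂ] B) (h : ∀ a, ‖π a‖ ≤ q a) : q.Completion →⋆ₐ[ℂ] B where
  toFun x := (q.preCLM π h).fromCompletion (show UniformSpace.Completion q.Pre from x)
  map_one' := by
    change (q.preCLM π h).fromCompletion ((1 : q.Pre) : UniformSpace.Completion q.Pre) = 1
    rw [ContinuousLinearMap.fromCompletion_apply_coe]
    exact _root_.map_one π
  map_mul' x y := by
    change (q.preCLM π h).fromCompletion ((show UniformSpace.Completion q.Pre from x) *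
      (show UniformSpace.Completion q.Pre from y)) = _
    induction x, y using UniformSpace.Completion.induction_on₂ with
    | hp => apply isClosed_eq <;> fun_prop
    | ih a b =>
      rw [← UniformSpace.Completion.coe_mul]
      simp only [ContinuousLinearMap.fromCompletion_apply_coe]
      exact _root_.map_mul π (show F from a) (show F from b)
  map_zero' := _root_.map_zero _
  map_add' x y := _root_.map_add (q.preCLM π h).fromCompletion _ _
  commutes' c := by
    change (q.preCLM π h).fromCompletion
      ((algebraMap ℂ q.Pre c : q.Pre) : UniformSpace.Completion q.Pre) = _
    rw [ContinuousLinearMap.fromCompletion_apply_coe]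
    exact AlgHomClass.commutes π c
  map_star' x := by
    change (q.preCLM π h).fromCompletion (star (show UniformSpace.Completion q.Pre from x)) = _
    induction x using UniformSpace.Completion.induction_on with
    | hp => apply isClosed_eq <;> fun_prop
    | ih a =>
      rw [← coe_star_pre]
      simp only [ContinuousLinearMap.fromCompletion_apply_coe]
      exact StarHomClass.map_star π (show F from a)

theorem lift_toCompletion (π : F →⋆ₐ[ℂ] B) (h : ∀ a, ‖π a‖ ≤ q a) (a : F) :
    q.lift π h (q.toCompletion a) = π a :=
  ContinuousLinearMap.fromCompletion_apply_coe (q.preCLM π h) (show q.Pre from a)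

end Completion

end CStarSeminorm

/-! ### The free *-algebra and universal C*-algebras given by generators and relations -/

/-- The free unital complex *-algebra on `X`: noncommutative polynomials in the letters
`x` (left summand) and `x*` (right summand). -/
def FreeStarAlgebra (X : Type u) : Type u := FreeAlgebra ℂ (X ⊕ X)

namespace FreeStarAlgebra

variable {X : Type u}

instance : Ring (FreeStarAlgebra X) := inferInstanceAs (Ring (FreeAlgebra ℂ (X ⊕ X)))
instance : Algebra ℂ (FreeStarAlgebra X) := inferInstanceAs (Algebra ℂ (FreeAlgebra ℂ (X ⊕ X)))

/-- The letters of the free *-algebra. -/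
def letter (x : X ⊕ X) : FreeStarAlgebra X := FreeAlgebra.ι ℂ x

/-- The generators of the free *-algebra. -/
def gen (x : X) : FreeStarAlgebra X := letter (Sum.inl x)

@[elab_as_elim]
theorem induction {motive : FreeStarAlgebra X → Prop}
    (scalar : ∀ c : ℂ, motive (algebraMap ℂ _ c)) (letter : ∀ x, motive (letter x))
    (mul : ∀ a b, motive a → motive b → motive (a * b))
    (add : ∀ a b, motive a → motive b → motive (a + b)) (a : FreeStarAlgebra X) : motive a :=
  FreeAlgebra.induction ℂ (X ⊕ X) (motive := motive) scalar letter mul add a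

/-- The opposite ring of the free algebra, with scalars acting through complex conjugation. -/
def ConjOp (X : Type u) : Type u := (FreeStarAlgebra X)ᵐᵒᵖ

instance : Ring (ConjOp X) := inferInstanceAs (Ring (FreeStarAlgebra X)ᵐᵒᵖ)

instance : Algebra ℂ (ConjOp X) :=
  RingHom.toAlgebra' ((algebraMap ℂ (FreeStarAlgebra X)ᵐᵒᵖ).comp (starRingEnd ℂ))
    (fun c a => Algebra.commutes (A := (FreeStarAlgebra X)ᵐᵒᵖ) (starRingEnd ℂ c) a)

/-- The conjugate-linear antimultiplicative map exchanging `x` and `x*`. -/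
def starHom : FreeStarAlgebra X →ₐ[ℂ] ConjOp X :=
  FreeAlgebra.lift ℂ (fun x : X ⊕ X => (MulOpposite.op (letter x.swap) : (FreeStarAlgebra X)ᵐᵒᵖ))

instance : Star (FreeStarAlgebra X) where
  star a := MulOpposite.unop (α := FreeStarAlgebra X) (starHom a)

theorem star_letter (x : X ⊕ X) : star (letter x) = letter x.swap := by
  change MulOpposite.unop (α := FreeStarAlgebra X) (starHom (letter x)) = _
  have h : starHom (letter x) =
      (MulOpposite.op (letter x.swap) : (FreeStarAlgebra X)ᵐᵒᵖ) :=
    FreeAlgebra.lift_ι_apply (R := ℂ) (A := ConjOp X) _ x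
  rw [h]
  rfl

theorem star_scalar (c : ℂ) : star (algebraMap ℂ (FreeStarAlgebra X) c) =
    algebraMap ℂ (FreeStarAlgebra X) (starRingEnd ℂ c) := by
  change MulOpposite.unop (α := FreeStarAlgebra X) (starHom (algebraMap ℂ _ c)) = _
  rw [AlgHom.commutes]
  rfl

theorem star_mul' (a b : FreeStarAlgebra X) : star (a * b) = star b * star a := by
  change MulOpposite.unop (α := FreeStarAlgebra X) (starHom (a * b)) = _
  rw [map_mul]
  rfl

theorem star_add' (a b : FreeStarAlgebra X) : star (a + b) = star a + star b := by
  change MulOpposite.unop (α := FreeStarAlgebra X) (starHom (a + b)) = _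
  rw [map_add]
  rfl

instance : StarRing (FreeStarAlgebra X) where
  star_mul := star_mul'
  star_add := star_add'
  star_involutive a := by
    induction a using FreeStarAlgebra.induction with
    | scalar c => rw [star_scalar, star_scalar, Complex.conj_conj]
    | letter x => rw [star_letter, star_letter, Sum.swap_swap]
    | mul a b ha hb => rw [star_mul', star_mul', ha, hb]
    | add a b ha hb => rw [star_add', star_add', ha, hb]

instance : StarModule ℂ (FreeStarAlgebra X) where
  star_smul c a := by
    rw [Algebra.smul_def, star_mul', star_scalar, ← Algebra.commutes, Algebra.smul_def]
    rfl

variable {B : Type v} [Ring B] [StarRing B] [Algebra ℂ B] [StarModule ℂ B]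

/-- The *-homomorphism out of the free *-algebra with prescribed values on the generators. -/
def lift (f : X → B) : FreeStarAlgebra X →⋆ₐ[ℂ] B :=
  let φ : FreeStarAlgebra X →ₐ[ℂ] B :=
    FreeAlgebra.lift ℂ (Sum.elim f (fun x => star (f x)))
  have hφ : ∀ x, φ (letter x) = Sum.elim f (fun x => star (f x)) x := fun x =>
    FreeAlgebra.lift_ι_apply (R := ℂ) (A := B) _ x
  { φ with
    map_star' := fun a => by
      change φ (star a) = star (φ a)
      induction a using FreeStarAlgebra.induction with
      | scalar c =>
        rw [star_scalar, AlgHom.commutes, AlgHom.commutes, ← algebraMap_star_comm]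
        rfl
      | letter x => rw [star_letter, hφ, hφ]; cases x <;> simp
      | mul a b ha hb => rw [star_mul, map_mul, map_mul, star_mul, ha, hb]
      | add a b ha hb => rw [star_add, map_add, map_add, star_add, ha, hb] }

theorem lift_gen (f : X → B) (x : X) : lift f (gen x) = f x :=
  FreeAlgebra.lift_ι_apply (R := ℂ) (A := B) _ (Sum.inl x)

end FreeStarAlgebra

/-- The C*-seminorms on the free *-algebra which vanish on a given set of relators. -/
def RelSeminorm {X : Type u} (R : Set (FreeStarAlgebra X)) : Type u :=
  {q : CStarSeminorm (FreeStarAlgebra X) // ∀ r ∈ R, q r = 0}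

/-- A set of relators is bounded if it bounds the norm of each generator; exactly then the universal
C*-algebra exists. -/
class BoundedRelations {X : Type u} (R : Set (FreeStarAlgebra X)) : Prop where
  bounded : ∀ x : X, ∃ C : ℝ, ∀ q : RelSeminorm R, q.1 (FreeStarAlgebra.gen x) ≤ C

section Universal

variable {X : Type u} (R : Set (FreeStarAlgebra X)) [BoundedRelations R]

theorem bddAbove_relSeminorm (a : FreeStarAlgebra X) :
    BddAbove (Set.range fun q : RelSeminorm R => q.1 a) := by
  suffices h : ∃ C : ℝ, 0 ≤ C ∧ ∀ q : RelSeminorm R, q.1 a ≤ C by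
    obtain ⟨C, -, hC⟩ := h
    exact ⟨C, by rintro _ ⟨q, rfl⟩; exact hC q⟩
  induction a using FreeStarAlgebra.induction with
  | scalar c =>
    refine ⟨‖c‖, norm_nonneg c, fun q => ?_⟩
    rw [Algebra.algebraMap_eq_smul_one, map_smul_eq_mul]
    exact mul_le_of_le_one_right (norm_nonneg c) q.1.map_one_le
  | letter x =>
    have h : ∀ y : X, ∃ C : ℝ, 0 ≤ C ∧ ∀ q : RelSeminorm R, q.1 (FreeStarAlgebra.gen y) ≤ C := by
      intro y
      obtain ⟨C, hC⟩ := BoundedRelations.bounded (R := R) y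
      exact ⟨max C 0, le_max_right _ _, fun q => (hC q).trans (le_max_left _ _)⟩
    cases x with
    | inl y => exact h y
    | inr y =>
      obtain ⟨C, h0, hC⟩ := h y
      refine ⟨C, h0, fun q => ?_⟩
      have : FreeStarAlgebra.letter (Sum.inr y : X ⊕ X) = star (FreeStarAlgebra.gen y) := by
        rw [FreeStarAlgebra.gen, FreeStarAlgebra.star_letter, Sum.swap_inl]
      rw [this, q.1.map_star]
      exact hC q
  | mul a b ha hb =>
    obtain ⟨C, hC0, hC⟩ := ha
    obtain ⟨D, hD0, hD⟩ := hb
    exact ⟨C * D, mul_nonneg hC0 hD0, fun q => (q.1.mul_le a b).trans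
      (mul_le_mul (hC q) (hD q) (q.1.nonneg b) hC0)⟩
  | add a b ha hb =>
    obtain ⟨C, hC0, hC⟩ := ha
    obtain ⟨D, hD0, hD⟩ := hb
    exact ⟨C + D, add_nonneg hC0 hD0, fun q => (map_add_le_add q.1.toSeminorm a b).trans
      (add_le_add (hC q) (hD q))⟩

/-- The largest C*-seminorm on the free *-algebra vanishing on the relators. -/
def universalSeminorm : CStarSeminorm (FreeStarAlgebra X) :=
  CStarSeminorm.sup (fun q : RelSeminorm R => q.1) (bddAbove_relSeminorm R)

/-- The universal unital C*-algebra with generators `X` and relators `R`. -/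
def UniversalCStar : Type u := (universalSeminorm R).Completion

namespace UniversalCStar

instance : CStarAlgebra (UniversalCStar R) :=
  inferInstanceAs (CStarAlgebra (universalSeminorm R).Completion)

instance : PartialOrder (UniversalCStar R) := CStarAlgebra.spectralOrder _

instance : StarOrderedRing (UniversalCStar R) := CStarAlgebra.spectralOrderedRing _

/-- The canonical map from the free *-algebra. -/
def mk : FreeStarAlgebra X →⋆ₐ[ℂ] UniversalCStar R := (universalSeminorm R).toCompletion

/-- The generators of the universal C*-algebra. -/
def gen (x : X) : UniversalCStar R := mk R (FreeStarAlgebra.gen x)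

theorem mk_eq_zero {r : FreeStarAlgebra X} (hr : r ∈ R) : mk R r = 0 := by
  rw [← norm_eq_zero]
  refine ((universalSeminorm R).norm_toCompletion r).trans ?_
  refine (CStarSeminorm.sup_apply _ (bddAbove_relSeminorm R) r).trans ?_
  have h : ∀ q : RelSeminorm R, q.1 r = 0 := fun q => q.2 r hr
  simp only [h]
  exact Real.iSup_const_zero

variable {B : Type v} [CStarAlgebra B]

/-- The universal property: generators in a C*-algebra satisfying the relations define a
*-homomorphism. -/
def lift (f : X → B) (h : ∀ r ∈ R, FreeStarAlgebra.lift f r = 0) : UniversalCStar R →⋆ₐ[ℂ] B :=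
  (universalSeminorm R).lift (FreeStarAlgebra.lift f) (fun a =>
    CStarSeminorm.le_sup (fun q : RelSeminorm R => q.1) (bddAbove_relSeminorm R)
      ⟨CStarSeminorm.ofHom (FreeStarAlgebra.lift f), fun r hr => by
        rw [CStarSeminorm.ofHom_apply, h r hr, norm_zero]⟩ a)

theorem lift_gen (f : X → B) (h : ∀ r ∈ R, FreeStarAlgebra.lift f r = 0) (x : X) :
    lift R f h (gen R x) = f x :=
  ((universalSeminorm R).lift_toCompletion _ _ _).trans (FreeStarAlgebra.lift_gen f x)

end UniversalCStar

end Universal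

/-! ### States and the minimal (spatial) tensor product -/

/-- A state of a unital C*-algebra: a positive linear functional with `φ 1 = 1`. -/
def CStarState (A : Type u) [CStarAlgebra A] [PartialOrder A] : Type u :=
  {φ : A →ₚ[ℂ] ℂ // φ 1 = 1}

instance (A : Type u) [CStarAlgebra A] [PartialOrder A] :
    CoeFun (CStarState A) (fun _ => A → ℂ) := ⟨fun φ => φ.1⟩

section Spatial

variable (H : Type u) [NormedAddCommGroup H] [InnerProductSpace ℂ H]
variable (K : Type v) [NormedAddCommGroup K] [InnerProductSpace ℂ K]

/-- The Hilbert space tensor product. -/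
def HilbertTensor : Type (max u v) := UniformSpace.Completion (H ⊗[ℂ] K)

instance : NormedAddCommGroup (HilbertTensor H K) :=
  inferInstanceAs (NormedAddCommGroup (UniformSpace.Completion (H ⊗[ℂ] K)))

instance : InnerProductSpace ℂ (HilbertTensor H K) :=
  inferInstanceAs (InnerProductSpace ℂ (UniformSpace.Completion (H ⊗[ℂ] K)))

instance : CompleteSpace (HilbertTensor H K) :=
  inferInstanceAs (CompleteSpace (UniformSpace.Completion (H ⊗[ℂ] K)))

variable {H K}

/-- The inclusion of the algebraic tensor product in the Hilbert space tensor product. -/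
def HilbertTensor.incl (x : H ⊗[ℂ] K) : HilbertTensor H K :=
  (x : UniformSpace.Completion (H ⊗[ℂ] K))

theorem HilbertTensor.denseRange_incl :
    DenseRange (HilbertTensor.incl : H ⊗[ℂ] K → HilbertTensor H K) :=
  UniformSpace.Completion.denseRange_coe

theorem HilbertTensor.incl_add (x y : H ⊗[ℂ] K) :
    HilbertTensor.incl (x + y) = HilbertTensor.incl x + HilbertTensor.incl y :=
  UniformSpace.Completion.coe_add x y

theorem HilbertTensor.incl_zero : HilbertTensor.incl (0 : H ⊗[ℂ] K) = 0 :=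
  UniformSpace.Completion.coe_zero

theorem HilbertTensor.incl_smul (c : ℂ) (x : H ⊗[ℂ] K) :
    HilbertTensor.incl (c • x) = c • HilbertTensor.incl x :=
  UniformSpace.Completion.coe_smul c x

theorem HilbertTensor.inner_incl (x y : H ⊗[ℂ] K) :
    ⟪HilbertTensor.incl x, HilbertTensor.incl y⟫_ℂ = ⟪x, y⟫_ℂ :=
  UniformSpace.Completion.inner_coe x y

theorem HilbertTensor.ext_incl {S T : HilbertTensor H K →L[ℂ] HilbertTensor H K}
    (h : ∀ x : H ⊗[ℂ] K, S (HilbertTensor.incl x) = T (HilbertTensor.incl x)) : S = T := by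
  ext x
  refine congrFun (HilbertTensor.denseRange_incl.equalizer S.continuous T.continuous ?_) x
  funext y
  exact h y

/-- The extension of an operator to the Hilbert space tensor product. -/
def HilbertTensor.extend (S : (H ⊗[ℂ] K) →L[ℂ] (H ⊗[ℂ] K)) :
    HilbertTensor H K →L[ℂ] HilbertTensor H K :=
  S.completion

theorem HilbertTensor.extend_incl (S : (H ⊗[ℂ] K) →L[ℂ] (H ⊗[ℂ] K)) (x : H ⊗[ℂ] K) :
    HilbertTensor.extend S (HilbertTensor.incl x) = HilbertTensor.incl (S x) :=
  ContinuousLinearMap.completion_apply_coe S x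

theorem HilbertTensor.extend_adjoint {S T : (H ⊗[ℂ] K) →L[ℂ] (H ⊗[ℂ] K)}
    (h : ∀ x y, ⟪S x, y⟫_ℂ = ⟪x, T y⟫_ℂ) :
    HilbertTensor.extend S = star (HilbertTensor.extend T) := by
  rw [ContinuousLinearMap.star_eq_adjoint, ContinuousLinearMap.eq_adjoint_iff]
  intro x y
  refine HilbertTensor.denseRange_incl.induction_on₂
    (p := fun x y => ⟪HilbertTensor.extend S x, y⟫_ℂ = ⟪x, HilbertTensor.extend T y⟫_ℂ)
    ?_ (fun x y => ?_) x y
  · apply isClosed_eq <;> fun_prop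
  · simp only [HilbertTensor.extend_incl, HilbertTensor.inner_incl, h]

theorem rTensor_adjoint [CompleteSpace H] (S : H →L[ℂ] H) (x y : H ⊗[ℂ] K) :
    ⟪(star S).rTensor K x, y⟫_ℂ = ⟪x, S.rTensor K y⟫_ℂ := by
  induction x with
  | zero => simp
  | add x x' hx hx' => simp only [map_add, inner_add_left, hx, hx']
  | tmul a b =>
    induction y with
    | zero => simp
    | add y y' hy hy' => simp only [map_add, inner_add_right, hy, hy']
    | tmul c d =>
      simp [ContinuousLinearMap.star_eq_adjoint, ContinuousLinearMap.adjoint_inner_left]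

theorem lTensor_adjoint [CompleteSpace K] (S : K →L[ℂ] K) (x y : H ⊗[ℂ] K) :
    ⟪(star S).lTensor H x, y⟫_ℂ = ⟪x, S.lTensor H y⟫_ℂ := by
  induction x with
  | zero => simp
  | add x x' hx hx' => simp only [map_add, inner_add_left, hx, hx']
  | tmul a b =>
    induction y with
    | zero => simp
    | add y y' hy hy' => simp only [map_add, inner_add_right, hy, hy']
    | tmul c d =>
      simp [ContinuousLinearMap.star_eq_adjoint, ContinuousLinearMap.adjoint_inner_left]

variable [CompleteSpace H] [CompleteSpace K]

/-- `S ↦ S ⊗ 1`. -/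
def ampLeft : (H →L[ℂ] H) →⋆ₐ[ℂ] (HilbertTensor H K →L[ℂ] HilbertTensor H K) where
  toFun S := HilbertTensor.extend (S.rTensor K)
  map_one' := HilbertTensor.ext_incl fun x => by simp [HilbertTensor.extend_incl]
  map_mul' S T := HilbertTensor.ext_incl fun x => by
    simp [HilbertTensor.extend_incl, ContinuousLinearMap.rTensor_mul]
  map_zero' := HilbertTensor.ext_incl fun x => by
    simp [HilbertTensor.extend_incl, HilbertTensor.incl_zero]
  map_add' S T := HilbertTensor.ext_incl fun x => by
    simp [HilbertTensor.extend_incl, HilbertTensor.incl_add]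
  commutes' c := HilbertTensor.ext_incl fun x => by
    simp [Algebra.algebraMap_eq_smul_one, HilbertTensor.extend_incl, HilbertTensor.incl_smul]
  map_star' S := HilbertTensor.extend_adjoint (rTensor_adjoint S)

/-- `T ↦ 1 ⊗ T`. -/
def ampRight : (K →L[ℂ] K) →⋆ₐ[ℂ] (HilbertTensor H K →L[ℂ] HilbertTensor H K) where
  toFun T := HilbertTensor.extend (T.lTensor H)
  map_one' := HilbertTensor.ext_incl fun x => by simp [HilbertTensor.extend_incl]
  map_mul' S T := HilbertTensor.ext_incl fun x => by
    simp [HilbertTensor.extend_incl, ContinuousLinearMap.lTensor_mul]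
  map_zero' := HilbertTensor.ext_incl fun x => by
    simp [HilbertTensor.extend_incl, HilbertTensor.incl_zero]
  map_add' S T := HilbertTensor.ext_incl fun x => by
    simp [HilbertTensor.extend_incl, HilbertTensor.incl_add]
  commutes' c := HilbertTensor.ext_incl fun x => by
    simp [Algebra.algebraMap_eq_smul_one, HilbertTensor.extend_incl, HilbertTensor.incl_smul]
  map_star' S := HilbertTensor.extend_adjoint (lTensor_adjoint S)

theorem ampLeft_commute (S : H →L[ℂ] H) (T : K →L[ℂ] K) :
    Commute (ampLeft S : HilbertTensor H K →L[ℂ] HilbertTensor H K) (ampRight T) :=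
  HilbertTensor.ext_incl fun x => by
    change HilbertTensor.extend (S.rTensor K) (HilbertTensor.extend (T.lTensor H) _) =
      HilbertTensor.extend (T.lTensor H) (HilbertTensor.extend (S.rTensor K) _)
    simp only [HilbertTensor.extend_incl]
    congr 1
    induction x with
    | zero => simp
    | add x y hx hy => simp only [map_add, hx, hy]
    | tmul a b => simp

variable {A : Type*} {B : Type*} [CStarAlgebra A] [CStarAlgebra B]

/-- The representation `π ⊗ σ` of the algebraic tensor product `A ⊗ B` on the Hilbert space
tensor product, `(π ⊗ σ)(a ⊗ b) = (π a ⊗ 1)(1 ⊗ σ b)`. -/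
def tensorRep (π : A →⋆ₐ[ℂ] (H →L[ℂ] H)) (σ : B →⋆ₐ[ℂ] (K →L[ℂ] K)) :
    (A ⊗[ℂ] B) →⋆ₐ[ℂ] (HilbertTensor H K →L[ℂ] HilbertTensor H K) :=
  let φ : (A ⊗[ℂ] B) →ₐ[ℂ] (HilbertTensor H K →L[ℂ] HilbertTensor H K) :=
    Algebra.TensorProduct.lift (ampLeft.comp π).toAlgHom (ampRight.comp σ).toAlgHom
      (fun a b => ampLeft_commute (π a) (σ b))
  have hφ : ∀ a b, φ (a ⊗ₜ b) = ampLeft (π a) * ampRight (σ b) := fun a b =>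
    Algebra.TensorProduct.lift_tmul _ _ _ a b
  { φ with
    map_star' := fun x => by
      change φ (star x) = star (φ x)
      induction x with
      | zero => simp
      | add x y hx hy => rw [star_add, map_add, map_add, star_add, hx, hy]
      | tmul a b =>
        rw [TensorProduct.star_tmul, hφ, hφ, star_mul, ← map_star, ← map_star, ← map_star,
          ← map_star]
        exact (ampLeft_commute (π (star a)) (σ (star b))).eq }

theorem tensorRep_tmul (π : A →⋆ₐ[ℂ] (H →L[ℂ] H)) (σ : B →⋆ₐ[ℂ] (K →L[ℂ] K)) (a : A) (b : B) :
    tensorRep π σ (a ⊗ₜ b) = ampLeft (π a) * ampRight (σ b) :=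
  Algebra.TensorProduct.lift_tmul (ampLeft.comp π).toAlgHom (ampRight.comp σ).toAlgHom
    (fun a b => ampLeft_commute (π a) (σ b)) a b

end Spatial

section MinTensor

variable (A : Type u) [CStarAlgebra A] [PartialOrder A] [StarOrderedRing A]
variable (B : Type v) [CStarAlgebra B] [PartialOrder B] [StarOrderedRing B]

/-- The C*-seminorm on the algebraic tensor product given by the tensor product of the GNS
representations of two states. -/
def gnsTensorSeminorm (s : CStarState A × CStarState B) : CStarSeminorm (A ⊗[ℂ] B) :=
  CStarSeminorm.ofHom (tensorRep s.1.1.gnsStarAlgHom s.2.1.gnsStarAlgHom)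

theorem bddAbove_gnsTensorSeminorm (x : A ⊗[ℂ] B) :
    BddAbove (Set.range fun s : CStarState A × CStarState B => gnsTensorSeminorm A B s x) := by
  suffices h : ∃ C : ℝ, ∀ s : CStarState A × CStarState B, gnsTensorSeminorm A B s x ≤ C by
    obtain ⟨C, hC⟩ := h
    exact ⟨C, by rintro _ ⟨s, rfl⟩; exact hC s⟩
  induction x with
  | zero => exact ⟨0, fun s => (map_zero (gnsTensorSeminorm A B s).toSeminorm).le⟩
  | add x y hx hy =>
    obtain ⟨C, hC⟩ := hx
    obtain ⟨D, hD⟩ := hy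
    exact ⟨C + D, fun s => (map_add_le_add (gnsTensorSeminorm A B s).toSeminorm x y).trans
      (add_le_add (hC s) (hD s))⟩
  | tmul a b =>
    refine ⟨‖a‖ * ‖b‖, fun s => ?_⟩
    rw [gnsTensorSeminorm, CStarSeminorm.ofHom_apply, tensorRep_tmul]
    refine (norm_mul_le _ _).trans (mul_le_mul ?_ ?_ (norm_nonneg _) (norm_nonneg _))
    · exact (NonUnitalStarAlgHom.norm_apply_le _ _).trans (NonUnitalStarAlgHom.norm_apply_le _ _)
    · exact (NonUnitalStarAlgHom.norm_apply_le _ _).trans (NonUnitalStarAlgHom.norm_apply_le _ _)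

/-- The minimal (spatial) C*-norm on the algebraic tensor product. -/
def minTensorSeminorm : CStarSeminorm (A ⊗[ℂ] B) :=
  CStarSeminorm.sup (gnsTensorSeminorm A B) (bddAbove_gnsTensorSeminorm A B)

/-- The minimal tensor product of two unital C*-algebras. -/
def MinTensor : Type (max u v) := (minTensorSeminorm A B).Completion

instance : CStarAlgebra (MinTensor A B) :=
  inferInstanceAs (CStarAlgebra (minTensorSeminorm A B).Completion)

variable {A B}

/-- The elementary tensor `a ⊗ b` in the minimal tensor product. -/
def minTmul (a : A) (b : B) : MinTensor A B := (minTensorSeminorm A B).toCompletion (a ⊗ₜ b)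

/-- `α : A → A ⊗ B` preserves the state `τ`: `(τ ⊗ id)(α a) = τ(a) 1` for all `a`, where the slice
map `τ ⊗ id` is the (unique) continuous linear map with `a ⊗ b ↦ τ(a) b`. -/
def PreservesState (α : A →⋆ₐ[ℂ] MinTensor A B) (τ : CStarState A) : Prop :=
  ∃ slice : MinTensor A B →L[ℂ] B,
    (∀ a b, slice (minTmul a b) = τ a • b) ∧ ∀ a, slice (α a) = τ a • 1

end MinTensor

/-! ### KMS states -/

/-- `τ` is a KMS state at inverse temperature `β` for the dynamics `σ`: it is `σ`-invariant
(automatic for `β ≠ 0`, part of the convention for `β = 0`) and `τ(a b) = τ(b σ_{iβ}(a))` for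
all `b` and all `a` for which `t ↦ σ_t(a)` extends to an entire function `z ↦ σ_z(a)`. -/
def IsKMSState {A : Type u} [CStarAlgebra A] [PartialOrder A] (σ : ℝ → A →⋆ₐ[ℂ] A) (β : ℝ)
    (τ : CStarState A) : Prop :=
  (∀ (t : ℝ) (a : A), τ (σ t a) = τ a) ∧
  ∀ (a b : A) (f : ℂ → A), Differentiable ℂ f → (∀ t : ℝ, f t = σ t a) →
    τ (a * b) = τ (b * f (Complex.I * β))

/-! ### Finite directed graphs without multiple edges and their C*-algebras

A directed graph without multiple edges (loops are allowed) is Mathlib's `Digraph V`; its group of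
automorphisms is the group `Γ.Adj ≃r Γ.Adj` of permutations of `V` that preserve and reflect the
edge relation. -/

namespace Digraph

variable {V : Type u} (Γ : Digraph V)

/-- The set of edges. -/
def Edge : Type u := {e : V × V // Γ.Adj e.1 e.2}

variable {Γ} in
/-- The source of an edge. -/
def Edge.src (e : Γ.Edge) : V := e.1.1

variable {Γ} in
/-- The target of an edge. -/
def Edge.tgt (e : Γ.Edge) : V := e.1.2

instance [Finite V] : Finite Γ.Edge := inferInstanceAs (Finite {e : V × V // Γ.Adj e.1 e.2})

instance [Fintype V] : Fintype Γ.Edge := Fintype.ofFinite _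

/-- No sinks: every vertex is the source of an edge. -/
def NoSinks : Prop := Function.Surjective (Edge.src : Γ.Edge → V)

/-- A graph with `m` vertices is circulant if its automorphism group contains the cyclic group of
order `m` acting by rotations, i.e. contains a cyclic permutation of all the vertices. -/
def IsCirculant : Prop := ∃ g : Γ.Adj ≃r Γ.Adj, Equiv.Perm.IsCycleOn g.toEquiv Set.univ

open scoped Classical in
/-- The vertex matrix. -/
def vertexMatrix : Matrix V V ℕ := Matrix.of fun v w => if Γ.Adj v w then 1 else 0

open scoped Classical in
/-- The spectral radius of the vertex matrix. -/
def vertexSpectralRadius [Fintype V] : ENNReal :=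
  spectralRadius ℂ (Γ.vertexMatrix.map (Nat.cast : ℕ → ℂ))

variable [Fintype V]

/-- The vertex letters. -/
def freeP (v : V) : FreeStarAlgebra (V ⊕ Γ.Edge) := FreeStarAlgebra.gen (Sum.inl v)

/-- The edge letters. -/
def freeS (e : Γ.Edge) : FreeStarAlgebra (V ⊕ Γ.Edge) := FreeStarAlgebra.gen (Sum.inr e)

open scoped Classical in
/-- The relations of the graph C*-algebra of a finite graph without sinks: the `p_v` are mutually
orthogonal projections with sum `1`, `S_e* S_e = p_{t(e)}` (so that the `S_e` are partial
isometries) and `∑_{s(e) = v} S_e S_e* = p_v`. -/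
inductive GraphRel : Set (FreeStarAlgebra (V ⊕ Γ.Edge))
  | idem (v : V) : GraphRel (Γ.freeP v * Γ.freeP v - Γ.freeP v)
  | selfAdjoint (v : V) : GraphRel (star (Γ.freeP v) - Γ.freeP v)
  | orthogonal (v w : V) (h : v ≠ w) : GraphRel (Γ.freeP v * Γ.freeP w)
  | unit : GraphRel (∑ v, Γ.freeP v - 1)
  | initial (e : Γ.Edge) : GraphRel (star (Γ.freeS e) * Γ.freeS e - Γ.freeP e.tgt)
  | range (v : V) : GraphRel
      (∑ e : Γ.Edge with e.src = v, Γ.freeS e * star (Γ.freeS e) - Γ.freeP v)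

instance : BoundedRelations Γ.GraphRel where
  bounded x := by
    refine ⟨1, fun q => ?_⟩
    have hp : ∀ v, q.1 (Γ.freeP v) ≤ 1 := by
      intro v
      have h1 := q.1.eq_of_sub (q.2 _ (GraphRel.idem v))
      have h2 := q.2 _ (GraphRel.selfAdjoint v)
      have h3 : q.1 (star (Γ.freeP v) * Γ.freeP v) = q.1 (Γ.freeP v * Γ.freeP v) := by
        refine q.1.eq_of_sub (le_antisymm ?_ (q.1.nonneg _))
        rw [← sub_mul]
        exact (q.1.mul_le _ _).trans (by rw [h2, zero_mul])
      have h4 := q.1.star_mul_self (Γ.freeP v)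
      nlinarith [q.1.nonneg (Γ.freeP v)]
    cases x with
    | inl v => exact hp v
    | inr e =>
      change q.1 (Γ.freeS e) ≤ 1
      have h1 := q.1.eq_of_sub (q.2 _ (GraphRel.initial e))
      have h2 := q.1.star_mul_self (Γ.freeS e)
      nlinarith [q.1.nonneg (Γ.freeS e), hp e.tgt]

/-- The graph C*-algebra `C*(Γ)`. -/
abbrev CStar : Type u := UniversalCStar Γ.GraphRel

/-- The vertex projections `p_v`. -/
def p (v : V) : Γ.CStar := UniversalCStar.gen Γ.GraphRel (Sum.inl v)

/-- The partial isometries `S_e`. -/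
def S (e : Γ.Edge) : Γ.CStar := UniversalCStar.gen Γ.GraphRel (Sum.inr e)

open scoped Classical in
/-- A Cuntz-Krieger `Γ`-family in a unital C*-algebra. -/
structure CKFamily (B : Type v) [CStarAlgebra B] where
  p : V → B
  S : Γ.Edge → B
  idem : ∀ v, p v * p v = p v
  selfAdjoint : ∀ v, star (p v) = p v
  orthogonal : ∀ v w, v ≠ w → p v * p w = 0
  unit : ∑ v, p v = 1
  initial : ∀ e, star (S e) * S e = p e.tgt
  range : ∀ v, ∑ e : Γ.Edge with e.src = v, S e * star (S e) = p v

/-- The generators of `C*(Γ)` form a Cuntz-Krieger family. -/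
def univFamily : Γ.CKFamily Γ.CStar where
  p := Γ.p
  S := Γ.S
  idem v := by
    have h := UniversalCStar.mk_eq_zero Γ.GraphRel (GraphRel.idem v)
    rw [map_sub, map_mul, sub_eq_zero] at h
    exact h
  selfAdjoint v := by
    have h := UniversalCStar.mk_eq_zero Γ.GraphRel (GraphRel.selfAdjoint v)
    rw [map_sub, map_star, sub_eq_zero] at h
    exact h
  orthogonal v w hvw := by
    have h := UniversalCStar.mk_eq_zero Γ.GraphRel (GraphRel.orthogonal v w hvw)
    rw [map_mul] at h
    exact h
  unit := by
    have h := UniversalCStar.mk_eq_zero Γ.GraphRel GraphRel.unit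
    rw [map_sub, map_sum, map_one, sub_eq_zero] at h
    exact h
  initial e := by
    have h := UniversalCStar.mk_eq_zero Γ.GraphRel (GraphRel.initial e)
    rw [map_sub, map_mul, map_star, sub_eq_zero] at h
    exact h
  range v := by
    have h := UniversalCStar.mk_eq_zero Γ.GraphRel (GraphRel.range v)
    rw [map_sub, map_sum, sub_eq_zero] at h
    simp only [map_mul, map_star] at h
    exact h

variable {Γ} in
/-- The *-homomorphism from `C*(Γ)` determined by a Cuntz-Krieger family. -/
def CKFamily.lift {B : Type v} [CStarAlgebra B] (F : Γ.CKFamily B) : Γ.CStar →⋆ₐ[ℂ] B :=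
  UniversalCStar.lift Γ.GraphRel (Sum.elim F.p F.S) (by
    have hp : ∀ v, FreeStarAlgebra.lift (Sum.elim F.p F.S) (Γ.freeP v) = F.p v := fun v =>
      FreeStarAlgebra.lift_gen _ _
    have hS : ∀ e, FreeStarAlgebra.lift (Sum.elim F.p F.S) (Γ.freeS e) = F.S e := fun e =>
      FreeStarAlgebra.lift_gen _ _
    intro r hr
    cases hr with
    | idem v => rw [map_sub, map_mul, hp, F.idem, sub_self]
    | selfAdjoint v => rw [map_sub, map_star, hp, F.selfAdjoint, sub_self]
    | orthogonal v w h => rw [map_mul, hp, hp, F.orthogonal v w h]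
    | unit => rw [map_sub, map_sum, map_one]; simp only [hp]; rw [F.unit, sub_self]
    | initial e => rw [map_sub, map_mul, map_star, hS, hp, F.initial, sub_self]
    | range v =>
      rw [map_sub, map_sum]
      simp only [map_mul, map_star, hS, hp]
      rw [F.range, sub_self])

variable {Γ} in
theorem CKFamily.lift_p {B : Type v} [CStarAlgebra B] (F : Γ.CKFamily B) (v : V) :
    F.lift (Γ.p v) = F.p v :=
  UniversalCStar.lift_gen Γ.GraphRel (Sum.elim F.p F.S) _ (Sum.inl v)

variable {Γ} in
theorem CKFamily.lift_S {B : Type v} [CStarAlgebra B] (F : Γ.CKFamily B) (e : Γ.Edge) :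
    F.lift (Γ.S e) = F.S e :=
  UniversalCStar.lift_gen Γ.GraphRel (Sum.elim F.p F.S) _ (Sum.inr e)

/-- The gauge action: `γ_z(p_v) = p_v`, `γ_z(S_e) = z S_e`. -/
def gauge (z : Circle) : Γ.CStar →⋆ₐ[ℂ] Γ.CStar :=
  CKFamily.lift (Γ := Γ)
    { p := Γ.p
      S := fun e => (z : ℂ) • Γ.S e
      idem := Γ.univFamily.idem
      selfAdjoint := Γ.univFamily.selfAdjoint
      orthogonal := Γ.univFamily.orthogonal
      unit := Γ.univFamily.unit
      initial := fun e => by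
        have hz : star (z : ℂ) * (z : ℂ) = 1 := by
          simp [← Complex.normSq_eq_conj_mul_self]
        rw [star_smul, smul_mul_smul_comm, hz, one_smul]
        exact Γ.univFamily.initial e
      range := fun v => by
        have hz : (z : ℂ) * star (z : ℂ) = 1 := by
          simp [Complex.mul_conj]
        simp only [star_smul, smul_mul_smul_comm, hz, one_smul]
        exact Γ.univFamily.range v }

/-- The dynamics `σ_t = γ_{e^{it}}`. -/
def dynamics (t : ℝ) : Γ.CStar →⋆ₐ[ℂ] Γ.CStar := Γ.gauge (Circle.exp t)

/-- `τ` is a KMS state of `C*(Γ)` at inverse temperature `β`. -/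
def IsKMS (β : ℝ) (τ : CStarState Γ.CStar) : Prop := IsKMSState Γ.dynamics β τ

variable {Γ} in
/-- The action of an automorphism on edges. -/
def edgePerm (g : Γ.Adj ≃r Γ.Adj) : Γ.Edge ≃ Γ.Edge where
  toFun e := ⟨(g e.1.1, g e.1.2), g.map_rel_iff.2 e.2⟩
  invFun e := ⟨(g.symm e.1.1, g.symm e.1.2), g.symm.map_rel_iff.2 e.2⟩
  left_inv e := Subtype.ext (by simp)
  right_inv e := Subtype.ext (by simp)

/-- The action of `Aut(Γ)` on `C*(Γ)`: `p_v ↦ p_{g v}`, `S_e ↦ S_{g e}`. -/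
def autAction (g : Γ.Adj ≃r Γ.Adj) : Γ.CStar →⋆ₐ[ℂ] Γ.CStar :=
  CKFamily.lift (Γ := Γ)
    { p := fun v => Γ.p (g v)
      S := fun e => Γ.S (edgePerm g e)
      idem := fun v => Γ.univFamily.idem (g v)
      selfAdjoint := fun v => Γ.univFamily.selfAdjoint (g v)
      orthogonal := fun v w h => Γ.univFamily.orthogonal (g v) (g w) (g.injective.ne h)
      unit := (Equiv.sum_comp g.toEquiv Γ.p).trans Γ.univFamily.unit
      initial := fun e => Γ.univFamily.initial (edgePerm g e)
      range := fun v => by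
        refine Eq.trans ?_ (Γ.univFamily.range (g v))
        refine Finset.sum_equiv (edgePerm g) (fun e => ?_) (fun e _ => rfl)
        simp only [Finset.mem_filter, Finset.mem_univ, true_and]
        exact g.injective.eq_iff.symm }

/-- `τ` is invariant under `Aut(Γ)`. -/
def IsAutInvariant (τ : CStarState Γ.CStar) : Prop :=
  ∀ (g : Γ.Adj ≃r Γ.Adj) (a : Γ.CStar), τ (Γ.autAction g a) = τ a

/-! ### The quantum automorphism group -/

/-- The letters `u_{vw}`. -/
def freeU (v w : V) : FreeStarAlgebra (V × V) := FreeStarAlgebra.gen (v, w)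

/-- The relations of the quantum automorphism group of `Γ`: the matrix `A = (u_{vw})` is a magic
unitary (projections, with all row and column sums equal to `1`), and `A D = D A`. -/
inductive QAutRel : Set (FreeStarAlgebra (V × V))
  | idem (v w : V) : QAutRel (freeU v w * freeU v w - freeU v w)
  | selfAdjoint (v w : V) : QAutRel (star (freeU v w) - freeU v w)
  | row (v : V) : QAutRel (∑ w, freeU v w - 1)
  | col (w : V) : QAutRel (∑ v, freeU v w - 1)
  | comm (v w : V) : QAutRel
      (∑ x, (Γ.vertexMatrix x w : ℂ) • freeU v x - ∑ x, (Γ.vertexMatrix v x : ℂ) • freeU x w)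

instance : BoundedRelations Γ.QAutRel where
  bounded x := by
    refine ⟨1, fun q => ?_⟩
    obtain ⟨v, w⟩ := x
    change q.1 (freeU v w) ≤ 1
    have h1 := q.1.eq_of_sub (q.2 _ (QAutRel.idem v w))
    have h2 := q.2 _ (QAutRel.selfAdjoint v w)
    have h3 : q.1 (star (freeU v w) * freeU v w) = q.1 (freeU v w * freeU v w) := by
      refine q.1.eq_of_sub (le_antisymm ?_ (q.1.nonneg _))
      rw [← sub_mul]
      exact (q.1.mul_le _ _).trans (by rw [h2, zero_mul])
    have h4 := q.1.star_mul_self (freeU v w)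
    nlinarith [q.1.nonneg (freeU v w)]

/-- The C*-algebra of the quantum automorphism group `Q^aut_Ban(Γ)`. -/
abbrev QAut : Type u := UniversalCStar Γ.QAutRel

/-- The generators `u_{vw}`. -/
def uu (v w : V) : Γ.QAut := UniversalCStar.gen Γ.QAutRel (v, w)

/-- `α` is the action of `Q^aut_Ban(Γ)` on `C*(Γ)`; these formulas determine it uniquely. -/
def IsQAutAction (α : Γ.CStar →⋆ₐ[ℂ] MinTensor Γ.CStar Γ.QAut) : Prop :=
  (∀ v, α (Γ.p v) = ∑ k, minTmul (Γ.p k) (Γ.uu k v)) ∧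
  ∀ e : Γ.Edge, α (Γ.S e) =
    ∑ l : Γ.Edge, minTmul (Γ.S l) (Γ.uu l.src e.src * Γ.uu l.tgt e.tgt)

/-- `τ` is invariant under the quantum automorphism group: the action of `Q^aut_Ban(Γ)` on `C*(Γ)`
exists, and it preserves `τ`. -/
def IsQAutInvariant (τ : CStarState Γ.CStar) : Prop :=
  ∃ α : Γ.CStar →⋆ₐ[ℂ] MinTensor Γ.CStar Γ.QAut, Γ.IsQAutAction α ∧ PreservesState α τ

end Digraph

end

/-! A KMS state at inverse temperature `β` is the same as a gauge-invariant state with `τ(S_e a) = c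
τ(a S_e)` and `τ(a S_e*) = c τ(S_e* a)`, where `c = e^{-β}`; such functionals are called conformal
(`IsConformal`). The monomials `S_μ S_ν*` span a dense subspace. Gauge invariance kills those with
`|μ| ≠ |ν|`, and for `|μ| = |ν|` conformality turns `S_μ S_ν*` into a multiple of `S_ν* S_μ`, a
combination of vertex projections. Hence a conformal functional is determined by `c` and its values
on the `p_v` (`IsConformal.ext`).

Uniqueness: a state invariant under the `m`-cycle takes the value `1/m` on every `p_v`. The identity
`τ(p_v) = e^{-β} ∑_w D_{vw} τ(p_w)` (`IsConformal.sum_apply_p`) then forces `e^β = λ`, and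
`IsConformal.ext` applies.

Existence: `C*(Γ)` acts on `ℓ²` of the infinite paths, which yields a state with values `1/m`. The
dual transfer operator `τ ↦ λ⁻¹ ∑_e τ(S_e* · S_e)` preserves these values, and a Banach limit of its
iterates is a fixed point, which satisfies the commutation relations (`S_mul_of_transfer_eq`). A
second Banach limit along the gauge action adds gauge invariance.

Quantum symmetry: the magic unitary relations together with `AD = DA` make the proposed images a
Cuntz-Krieger family in the tensor product, so the action exists (`coactFamily`). The slice map `τ ⊗
id` is bounded for the spatial norm (`norm_algSlice_le`), and invariance is checked on monomials by
induction on path length, peeling off one edge at each end (`IsConformal.minSlice_coaction_conj`);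
the base case uses that `τ` is constant on the `p_v`. -/

noncomputable section

universe u v

/-! ### Projections and states -/

section CStarGeneral

/-- Projections in a C*-algebra that sum up to `1` are mutually orthogonal. -/
theorem mul_eq_zero_of_sum_projections {A : Type*} [CStarAlgebra A] [PartialOrder A]
    [StarOrderedRing A] {ι : Type*} [Fintype ι] {q : ι → A} (hs : ∀ i, star (q i) = q i)
    (hi : ∀ i, q i * q i = q i) (h1 : ∑ i, q i = 1) {i j : ι} (hij : i ≠ j) :
    q i * q j = 0 := by
  classical
  -- Compressing `∑ q k = 1` by `q j` gives `∑ (q k q j)* (q k q j) = q j`. The term `k = j` already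
  -- equals `q j`, so the other terms, all positive, sum to zero.
  have h : ∑ k ∈ Finset.univ.erase j, star (q k * q j) * (q k * q j) = 0 := by
    have h2 : ∑ k, star (q k * q j) * (q k * q j) = q j := by
      have : ∀ k, star (q k * q j) * (q k * q j) = q j * q k * q j := fun k => by
        rw [star_mul, hs, hs, mul_assoc, ← mul_assoc (q k), hi, mul_assoc]
      simp only [this]
      rw [← Finset.sum_mul, ← Finset.mul_sum, h1, mul_one, hi]
    have hjj : star (q j * q j) * (q j * q j) = q j := by rw [hi, hs, hi]
    rw [← Finset.add_sum_erase _ _ (Finset.mem_univ j), hjj] at h2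
    exact add_eq_left.1 h2
  rw [Finset.sum_eq_zero_iff_of_nonneg (fun k _ => star_mul_self_nonneg _)] at h
  exact (CStarRing.star_mul_self_eq_zero_iff _).1 (h i (Finset.mem_erase.2 ⟨hij, Finset.mem_univ i⟩))

theorem CStarState.ext {A : Type u} [CStarAlgebra A] [PartialOrder A] {τ τ' : CStarState A}
    (h : ∀ a, τ a = τ' a) : τ = τ' :=
  Subtype.ext (PositiveLinearMap.ext h)

variable {A : Type u} [CStarAlgebra A] [PartialOrder A] [StarOrderedRing A]

namespace CStarState

/-- The 4 counts the positive parts in the decomposition of `a`. Only uniformity in `τ` matters: it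
gives compactness and telescoping bounds for Banach limits. -/
theorem norm_apply_le (τ : CStarState A) (a : A) : ‖τ a‖ ≤ 4 * ‖a‖ := by
  obtain ⟨y, hy, hn, he⟩ := CStarAlgebra.exists_sum_four_nonneg a
  conv_lhs => rw [he]
  simp only [map_sum, map_smul]
  refine (norm_sum_le _ _).trans ?_
  refine (Finset.sum_le_sum (g := fun _ => ‖a‖) fun i _ => ?_).trans (by simp)
  rw [norm_smul, norm_pow, Complex.norm_I, one_pow, one_mul]
  refine (PositiveLinearMap.norm_apply_le_of_nonneg τ.1 _ (hy i)).trans ?_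
  rw [τ.2, norm_one, one_mul]
  exact hn i

/-- The continuous linear functional underlying a state. -/
def toCLM (τ : CStarState A) : A →L[ℂ] ℂ := ⟨τ.1.toLinearMap, map_continuous τ.1⟩

theorem toCLM_apply (τ : CStarState A) (a : A) : τ.toCLM a = τ a := rfl

/-- A state from a positive linear functional, given by its values on elements `star b * b`. -/
def ofLinear (φ : A →ₗ[ℂ] ℂ) (h1 : φ 1 = 1) (h : ∀ b, 0 ≤ φ (star b * b)) : CStarState A :=
  ⟨PositiveLinearMap.mk₀ φ (fun a ha => by
    obtain ⟨b, rfl⟩ := CStarAlgebra.nonneg_iff_eq_star_mul_self.1 ha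
    exact h b), h1⟩

theorem apply_star_mul_self_nonneg (τ : CStarState A) (b : A) : 0 ≤ τ (star b * b) :=
  τ.1.map_nonneg (star_mul_self_nonneg b)

/-- The pullback of a state along a unital *-homomorphism. -/
def comp {B : Type v} [CStarAlgebra B] [PartialOrder B] [StarOrderedRing B] (τ : CStarState A)
    (π : B →⋆ₐ[ℂ] A) : CStarState B :=
  ofLinear (τ.1.toLinearMap.comp π.toAlgHom.toLinearMap)
    (by change τ (π 1) = 1; rw [map_one]; exact τ.2)
    (fun b => by
      change 0 ≤ τ (π (star b * b))
      rw [map_mul, map_star]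
      exact τ.apply_star_mul_self_nonneg _)

theorem comp_apply {B : Type v} [CStarAlgebra B] [PartialOrder B] [StarOrderedRing B]
    (τ : CStarState A) (π : B →⋆ₐ[ℂ] A) (b : B) : τ.comp π b = τ (π b) := rfl

open Filter Topology in
/-- A Banach limit of a sequence of states. -/
theorem exists_banachLimit (τ : ℕ → CStarState A) :
    ∃ ρ : CStarState A, (∀ (a : A) (c : ℂ), (∀ n, τ n a = c) → ρ a = c) ∧
      ∀ a b : A, (∀ n, τ (n + 1) a = τ n b) → ρ a = ρ b := by
  -- Cesàro means, whose limit is taken along a nonprincipal ultrafilter; averaging over `N + 1`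
  -- terms keeps the denominator nonzero.
  let avg : A → ℕ → ℂ := fun a N => ((N : ℂ) + 1)⁻¹ * ∑ n ∈ Finset.range (N + 1), τ n a
  have hN : ∀ N : ℕ, ((N : ℂ) + 1) ≠ 0 := fun N => by exact_mod_cast N.succ_ne_zero
  have hNn : ∀ N : ℕ, ‖((N : ℂ) + 1)⁻¹‖ = ((N : ℝ) + 1)⁻¹ := fun N => by
    rw [norm_inv]
    congr 1
    exact_mod_cast Complex.norm_natCast (N + 1)
  have hbound : ∀ a N, ‖avg a N‖ ≤ 4 * ‖a‖ := fun a N => by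
    rw [norm_mul, hNn]
    have : ‖∑ n ∈ Finset.range (N + 1), τ n a‖ ≤ ((N : ℝ) + 1) * (4 * ‖a‖) := by
      refine (norm_sum_le _ _).trans ((Finset.sum_le_sum fun n _ => (τ n).norm_apply_le a).trans ?_)
      simp
    calc _ ≤ ((N : ℝ) + 1)⁻¹ * (((N : ℝ) + 1) * (4 * ‖a‖)) := by gcongr
      _ = _ := by field_simp
  have hlim : ∀ a, ∃ c, Tendsto (avg a) (hyperfilter ℕ) (𝓝 c) := fun a => by
    obtain ⟨c, -, hc⟩ := (isCompact_closedBall (0 : ℂ) (4 * ‖a‖)).ultrafilter_le_nhds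
      ((hyperfilter ℕ).map (avg a)) (by
        rw [le_principal_iff]
        exact Filter.mem_map.2 (Filter.univ_mem' fun N => by
          simpa using hbound a N))
    exact ⟨c, hc⟩
  choose ℓ hℓ using hlim
  have uniq : ∀ {a c}, Tendsto (avg a) (hyperfilter ℕ) (𝓝 c) → ℓ a = c := fun h =>
    tendsto_nhds_unique (hℓ _) h
  have hconst : ∀ (a : A) (c : ℂ), (∀ n, τ n a = c) → ℓ a = c := fun a c h => by
    refine uniq ?_
    have : avg a = fun _ => c := by
      funext N
      simp only [avg, h, Finset.sum_const, Finset.card_range, nsmul_eq_mul, Nat.cast_add,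
        Nat.cast_one]
      rw [← mul_assoc, inv_mul_cancel₀ (hN N), one_mul]
    rw [this]
    exact tendsto_const_nhds
  let φ : A →ₗ[ℂ] ℂ :=
    { toFun := ℓ
      map_add' := fun a b => uniq (((hℓ a).add (hℓ b)).congr fun N => by
        simp only [avg, map_add, Finset.sum_add_distrib, mul_add])
      map_smul' := fun c a => uniq (((hℓ a).const_mul c).congr fun N => by
        simp only [avg, map_smul, smul_eq_mul, ← Finset.mul_sum]
        ring) }
  refine ⟨ofLinear φ (hconst 1 1 fun n => (τ n).2) (fun b => ?_), hconst, fun a b h => ?_⟩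
  · refine ge_of_tendsto' (hℓ (star b * b)) fun N => mul_nonneg ?_
      (Finset.sum_nonneg fun n _ => (τ n).apply_star_mul_self_nonneg b)
    have : (0 : ℂ) ≤ (((N : ℝ) + 1)⁻¹ : ℝ) := by
      rw [Complex.zero_le_real]; positivity
    simpa using this
  -- The difference of the two means telescopes to `(τ (N + 1) a - τ 0 a) / (N + 1)`.
  · have hdiff : Tendsto (fun N => avg b N - avg a N) atTop (𝓝 0) := by
      have hle : ∀ N, ‖avg b N - avg a N‖ ≤ (4 * ‖a‖ + 4 * ‖a‖) * (1 / ((N : ℝ) + 1)) := fun N => by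
        have h1 : ∑ n ∈ Finset.range (N + 1), τ n b - ∑ n ∈ Finset.range (N + 1), τ n a
            = τ (N + 1) a - τ 0 a := by
          rw [← Finset.sum_sub_distrib, ← Finset.sum_range_sub (fun n => τ n a) (N + 1)]
          exact Finset.sum_congr rfl fun n _ => by rw [h]
        simp only [avg]
        rw [← mul_sub, h1, norm_mul, hNn, one_div, mul_comm]
        gcongr
        exact (norm_sub_le _ _).trans (add_le_add ((τ _).norm_apply_le a) ((τ _).norm_apply_le a))
      refine squeeze_zero_norm hle ?_
      simpa using (tendsto_one_div_add_atTop_nhds_zero_nat (𝕜 := ℝ)).const_mul (4 * ‖a‖ + 4 * ‖a‖)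
    have h2 := (hℓ b).sub (hℓ a)
    have h3 := hdiff.mono_left Nat.hyperfilter_le_atTop
    exact (sub_eq_zero.1 (tendsto_nhds_unique h2 h3)).symm

end CStarState

end CStarGeneral

/-! ### Norming states and slice maps -/

section Norming

/-- With `y = Im g(a)`, testing `g` on `a + it` gives `(y + t)² ≤ ‖a‖² + t²` for every real `t`. The
`t²` cancels, and what remains is affine in `t` with slope `2y`, hence unbounded unless `y = 0`. -/
theorem im_apply_eq_zero_of_norm_le_one {A : Type u} [CStarAlgebra A] [Nontrivial A]
    {g : A →L[ℂ] ℂ} (hg : ‖g‖ ≤ 1) (h1 : g 1 = 1) {a : A} (ha : IsSelfAdjoint a) : (g a).im = 0 := by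
  by_contra hy
  set y := (g a).im with hydef
  have key : ∀ t : ℝ, (y + t) ^ 2 ≤ ‖a‖ ^ 2 + t ^ 2 := fun t => by
    have hb : ‖a + (Complex.I * t) • (1 : A)‖ ^ 2 ≤ ‖a‖ ^ 2 + t ^ 2 := by
      rw [sq, ← CStarRing.norm_star_mul_self]
      have : star (a + (Complex.I * t) • (1 : A)) * (a + (Complex.I * t) • (1 : A))
          = a * a + ((t ^ 2 : ℝ) : ℂ) • (1 : A) := by
        rw [star_add, star_smul, star_one, ha.star_eq]
        have hc : star (Complex.I * (t : ℂ)) = -(Complex.I * t) := by simp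
        rw [hc, add_mul, mul_add, mul_add, smul_one_mul, smul_one_mul, mul_smul_one, smul_smul,
          neg_smul]
        have : -(Complex.I * (t : ℂ)) * (Complex.I * t) = ((t ^ 2 : ℝ) : ℂ) := by
          have := Complex.I_sq
          push_cast
          linear_combination (-(t : ℂ) ^ 2) * this
        rw [this]
        abel
      rw [this]
      refine (norm_add_le _ _).trans (add_le_add ((norm_mul_le _ _).trans_eq (sq _).symm) ?_)
      rw [norm_smul, Complex.norm_real, Real.norm_of_nonneg (by positivity)]
      have hn1 : ‖(1 : A)‖ ≤ 1 := norm_one.le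
      nlinarith [sq_nonneg t]
    have hc : ‖g (a + (Complex.I * t) • (1 : A))‖ ≤ ‖a + (Complex.I * t) • (1 : A)‖ :=
      (g.le_of_opNorm_le hg _).trans_eq (one_mul _)
    have hd : (g (a + (Complex.I * t) • (1 : A))).im = y + t := by
      simp [h1, hydef]
    have he := Complex.abs_im_le_norm (g (a + (Complex.I * t) • (1 : A)))
    rw [hd] at he
    calc (y + t) ^ 2 = |y + t| ^ 2 := (sq_abs _).symm
      _ ≤ ‖a + (Complex.I * t) • (1 : A)‖ ^ 2 := by gcongr; exact he.trans hc
      _ ≤ _ := hb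
  -- This `t` makes the cross term `2yt` equal to `‖a‖² + 1`, more than the bound allows.
  have := key ((‖a‖ ^ 2 + 1) / (2 * y))
  have h2 : 2 * y * ((‖a‖ ^ 2 + 1) / (2 * y)) = ‖a‖ ^ 2 + 1 := by field_simp
  nlinarith [sq_nonneg y]

variable {A : Type u} [CStarAlgebra A] [PartialOrder A] [StarOrderedRing A]

/-- The norm of a positive element lies in its spectrum, and adding `1` shifts the spectrum. -/
theorem norm_one_add_of_nonneg [Nontrivial A] {a : A} (ha : 0 ≤ a) : ‖1 + a‖ = 1 + ‖a‖ := by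
  refine le_antisymm ((norm_add_le _ _).trans_eq (by rw [norm_one])) ?_
  have h1 : ‖a‖ ∈ spectrum ℝ a := CStarAlgebra.norm_mem_spectrum_of_nonneg ha
  have h2 : 1 + ‖a‖ ∈ spectrum ℝ (algebraMap ℝ A 1 + a) := by
    rw [add_comm 1 ‖a‖, spectrum.add_mem_add_iff]
    exact h1
  rw [map_one] at h2
  have h3 := spectrum.norm_le_norm_of_mem h2
  rwa [Real.norm_of_nonneg (by positivity)] at h3

/-- The element `‖a‖ - a` lies between `0` and `‖a‖`, so its norm is at most `‖a‖` and `‖a‖ - Re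
g(a) ≤ ‖a‖`. -/
theorem apply_nonneg_of_norm_le_one [Nontrivial A] {g : A →L[ℂ] ℂ} (hg : ‖g‖ ≤ 1) (h1 : g 1 = 1) {a : A}
    (ha : 0 ≤ a) : 0 ≤ g a := by
  refine Complex.nonneg_iff.2 ⟨?_, (im_apply_eq_zero_of_norm_le_one hg h1 (.of_nonneg ha)).symm⟩
  have hle : a ≤ algebraMap ℝ A ‖a‖ := IsSelfAdjoint.le_algebraMap_norm_self (.of_nonneg ha)
  have hb : ‖algebraMap ℝ A ‖a‖ - a‖ ≤ ‖a‖ := by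
    refine (CStarAlgebra.norm_le_norm_of_nonneg_of_le (sub_nonneg.2 hle)
      (sub_le_self _ ha)).trans ?_
    rw [norm_algebraMap]
    simp
  have hc : ‖g (algebraMap ℝ A ‖a‖ - a)‖ ≤ ‖a‖ :=
    ((g.le_of_opNorm_le hg _).trans_eq (one_mul _)).trans hb
  have hd : (g (algebraMap ℝ A ‖a‖ - a)).re = ‖a‖ - (g a).re := by
    rw [Algebra.algebraMap_eq_smul_one, ← Complex.coe_smul]
    simp [h1]
  have := (le_abs_self _).trans (Complex.abs_re_le_norm (g (algebraMap ℝ A ‖a‖ - a)))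
  linarith

/-- Every positive element of a nontrivial C*-algebra has a norming state. -/
theorem CStarState.exists_apply_eq_norm [Nontrivial A] {a : A} (ha : 0 ≤ a) :
    ∃ φ : CStarState A, φ a = ‖a‖ := by
  -- Norming `1 + a` instead of `a`: since `|g 1| ≤ 1` and `|g a| ≤ ‖a‖`, the equality `g 1 + g a =
  -- 1 + ‖a‖` forces both `g 1 = 1` and `g a = ‖a‖`.
  obtain ⟨g, hg, hga⟩ := exists_dual_vector'' ℂ (1 + a)
  rw [norm_one_add_of_nonneg ha, map_add, RCLike.ofReal_eq_complex_ofReal] at hga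
  have b1 : ‖g 1‖ ≤ 1 := (g.le_of_opNorm_le hg _).trans_eq (by rw [norm_one, one_mul])
  have b2 : ‖g a‖ ≤ ‖a‖ := (g.le_of_opNorm_le hg _).trans_eq (one_mul _)
  have hre := congrArg Complex.re hga
  rw [Complex.add_re, Complex.ofReal_re] at hre
  have r1 := Complex.re_le_norm (g 1)
  have r2 := Complex.re_le_norm (g a)
  have h1 : g 1 = 1 := by
    have : (g 1).re = ‖g 1‖ := by linarith
    rw [Complex.re_eq_norm] at this
    rw [Complex.eq_re_of_ofReal_le this]
    have : (g 1).re = 1 := by linarith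
    rw [this, Complex.ofReal_one]
  refine ⟨ofLinear g.toLinearMap h1
    (fun b => apply_nonneg_of_norm_le_one hg h1 (star_mul_self_nonneg b)), ?_⟩
  have hga' : g a = ‖a‖ := by
    rw [h1] at hga
    simpa using hga
  exact hga'

end Norming

/-! ### Slice maps on the minimal tensor product -/

section Slice

variable {A : Type u} [CStarAlgebra A] [PartialOrder A] [StarOrderedRing A]
variable {B : Type v} [CStarAlgebra B] [PartialOrder B] [StarOrderedRing B]

set_option linter.unusedSectionVars false

/-- The slice map `τ ⊗ id` on the algebraic tensor product. -/
def algSlice (τ : CStarState A) : A ⊗[ℂ] B →ₗ[ℂ] B :=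
  TensorProduct.lid ℂ B ∘ₗ TensorProduct.map τ.1.toLinearMap LinearMap.id

theorem algSlice_tmul (τ : CStarState A) (a : A) (b : B) :
    algSlice τ (a ⊗ₜ[ℂ] b) = τ a • b := by
  simp [algSlice]

/-- Realizes functionals of the slice as matrix coefficients of a GNS tensor representation, which
the spatial norm controls. -/
theorem inner_tensorRep_gns (τ : CStarState A) (φ : CStarState B) (x : A ⊗[ℂ] B) (c : B) :
    ⟪HilbertTensor.incl ((τ.1.toPreGNS 1 : τ.1.GNS) ⊗ₜ[ℂ] (φ.1.toPreGNS c : φ.1.GNS)),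
      tensorRep τ.1.gnsStarAlgHom φ.1.gnsStarAlgHom x
        (HilbertTensor.incl ((τ.1.toPreGNS 1 : τ.1.GNS) ⊗ₜ[ℂ] (φ.1.toPreGNS 1 : φ.1.GNS)))⟫_ℂ
      = φ (star c * algSlice τ x) := by
  induction x with
  | zero => simp
  | add x y hx hy =>
    rw [map_add, add_apply, inner_add_right, hx, hy, map_add, mul_add, map_add]
  | tmul a b =>
    rw [tensorRep_tmul, algSlice_tmul]
    change ⟪_, HilbertTensor.extend _ (HilbertTensor.extend _ _)⟫_ℂ = _
    rw [HilbertTensor.extend_incl, HilbertTensor.extend_incl, HilbertTensor.inner_incl]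
    simp [PositiveLinearMap.preGNS_inner_def]

/-- Let `b` be the slice of `x` and `φ` a state norming `b* b`. The matrix coefficient with `c = b`
equals `‖b‖²`, and its vectors have norms `‖b‖` and `1`, so Cauchy-Schwarz gives `‖b‖² ≤ ‖b‖ ‖(π_τ ⊗
π_φ)(x)‖`. -/
theorem norm_algSlice_le (τ : CStarState A) (x : A ⊗[ℂ] B) :
    ‖algSlice τ x‖ ≤ minTensorSeminorm A B x := by
  -- The zero algebra has no states and is treated apart.
  rcases subsingleton_or_nontrivial B with hB | hB
  · rw [Subsingleton.elim (algSlice τ x) 0, norm_zero]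
    exact CStarSeminorm.nonneg _ _
  set b := algSlice τ x with hb
  obtain ⟨φ, hφ⟩ := CStarState.exists_apply_eq_norm (star_mul_self_nonneg b)
  refine le_trans ?_ (CStarSeminorm.le_sup (gnsTensorSeminorm A B)
    (bddAbove_gnsTensorSeminorm A B) (τ, φ) x)
  have h := inner_tensorRep_gns τ φ x b
  rw [← hb, hφ, CStarRing.norm_star_mul_self] at h
  have hn : ∀ (y : B), ‖(HilbertTensor.incl ((τ.1.toPreGNS 1 : τ.1.GNS) ⊗ₜ[ℂ]
      (φ.1.toPreGNS y : φ.1.GNS)) : HilbertTensor τ.1.GNS φ.1.GNS)‖ ^ 2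
        = ‖φ (star y * y)‖ := fun y => by
    have h1 : ‖(HilbertTensor.incl ((τ.1.toPreGNS 1 : τ.1.GNS) ⊗ₜ[ℂ]
        (φ.1.toPreGNS y : φ.1.GNS)) : HilbertTensor τ.1.GNS φ.1.GNS)‖
          = ‖τ.1.toPreGNS 1‖ * ‖φ.1.toPreGNS y‖ := by
      refine (UniformSpace.Completion.norm_coe _).trans ?_
      rw [TensorProduct.norm_tmul, UniformSpace.Completion.norm_coe,
        UniformSpace.Completion.norm_coe]
    have h2 : ‖τ.1.toPreGNS 1‖ ^ 2 = 1 := by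
      have := τ.1.preGNS_norm_sq (τ.1.toPreGNS 1)
      rw [PositiveLinearMap.ofPreGNS_toPreGNS, star_one, mul_one, τ.2] at this
      exact_mod_cast this
    have h3 := φ.1.preGNS_norm_sq (φ.1.toPreGNS y)
    rw [PositiveLinearMap.ofPreGNS_toPreGNS] at h3
    rw [h1, mul_pow, h2, one_mul, ← h3]
    simp
  have hb' := hn b
  have h1' := hn 1
  rw [hφ, CStarRing.norm_star_mul_self] at hb'
  rw [star_one, one_mul, φ.2, norm_one] at h1'
  have hb2 : ‖(HilbertTensor.incl ((τ.1.toPreGNS 1 : τ.1.GNS) ⊗ₜ[ℂ]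
      (φ.1.toPreGNS b : φ.1.GNS)) : HilbertTensor τ.1.GNS φ.1.GNS)‖ = ‖b‖ := by
    refine (pow_left_inj₀ (norm_nonneg _) (norm_nonneg _) two_ne_zero).1 (hb'.trans ?_)
    simp [sq]
  have h12 := (pow_eq_one_iff_of_nonneg (norm_nonneg _) two_ne_zero).1 h1'
  have hle := (norm_inner_le_norm (𝕜 := ℂ) _ _).trans (mul_le_mul_of_nonneg_left
    ((tensorRep τ.1.gnsStarAlgHom φ.1.gnsStarAlgHom x).le_opNorm
      (HilbertTensor.incl ((τ.1.toPreGNS 1 : τ.1.GNS) ⊗ₜ[ℂ] (φ.1.toPreGNS 1 : φ.1.GNS))))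
    (norm_nonneg (HilbertTensor.incl ((τ.1.toPreGNS 1 : τ.1.GNS) ⊗ₜ[ℂ]
      (φ.1.toPreGNS b : φ.1.GNS)) : HilbertTensor τ.1.GNS φ.1.GNS)))
  rw [h, hb2, h12, mul_one] at hle
  change ‖b‖ ≤ ‖tensorRep τ.1.gnsStarAlgHom φ.1.gnsStarAlgHom x‖
  rcases (norm_nonneg b).eq_or_lt with h0 | h0
  · rw [← h0]; exact norm_nonneg _
  · refine le_of_mul_le_mul_left (le_trans ?_ hle) h0
    simp

/-- The slice map `τ ⊗ id` on the minimal tensor product. -/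
def minSlice (τ : CStarState A) : MinTensor A B →L[ℂ] B :=
  (LinearMap.mkContinuous
    ({ toFun := fun x => algSlice τ (show A ⊗[ℂ] B from x)
       map_add' := fun x y => map_add (algSlice τ) (show A ⊗[ℂ] B from x) (show A ⊗[ℂ] B from y)
       map_smul' := fun c x => map_smul (algSlice τ) c (show A ⊗[ℂ] B from x) } :
      (minTensorSeminorm A B).Pre →ₗ[ℂ] B) 1
    (fun x => by rw [one_mul]; exact norm_algSlice_le τ x)).fromCompletion

theorem minSlice_toCompletion (τ : CStarState A) (x : A ⊗[ℂ] B) :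
    minSlice τ ((minTensorSeminorm A B).toCompletion x) = algSlice τ x :=
  ContinuousLinearMap.fromCompletion_apply_coe _ (show (minTensorSeminorm A B).Pre from x)

theorem minSlice_minTmul (τ : CStarState A) (a : A) (b : B) :
    minSlice τ (minTmul a b) = τ a • b :=
  (minSlice_toCompletion τ _).trans (algSlice_tmul τ a b)

/-- Continuous linear maps on the minimal tensor product which agree on the elementary tensors are
equal. -/
theorem MinTensor.clm_ext {E : Type*} [NormedAddCommGroup E] [NormedSpace ℂ E]
    {f g : MinTensor A B →L[ℂ] E} (h : ∀ a b, f (minTmul a b) = g (minTmul a b)) : f = g := by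
  ext x
  refine (minTensorSeminorm A B).denseRange_toCompletion.induction_on x
    (isClosed_eq f.continuous g.continuous) fun y => ?_
  induction y with
  | zero => rw [map_zero]; exact (map_zero f).trans (map_zero g).symm
  | add x y hx hy =>
    rw [map_add]
    exact (map_add f _ _).trans ((congrArg₂ _ hx hy).trans (map_add g _ _).symm)
  | tmul a b => exact h a b

theorem minTmul_mul (a a' : A) (b b' : B) :
    minTmul a b * minTmul a' b' = minTmul (a * a') (b * b') := by
  refine (map_mul (minTensorSeminorm A B).toCompletion _ _).symm.trans ?_
  rw [Algebra.TensorProduct.tmul_mul_tmul]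
  rfl

theorem star_minTmul (a : A) (b : B) : star (minTmul a b) = minTmul (star a) (star b) := by
  refine (map_star (minTensorSeminorm A B).toCompletion _).symm.trans ?_
  rw [TensorProduct.star_tmul]
  rfl

theorem minTmul_one_one : minTmul (1 : A) (1 : B) = 1 :=
  map_one (minTensorSeminorm A B).toCompletion

/-- `minTmul` as a bilinear map. -/
def minTmulₗ : A →ₗ[ℂ] B →ₗ[ℂ] MinTensor A B :=
  (TensorProduct.mk ℂ A B).compr₂ (minTensorSeminorm A B).toCompletion.toAlgHom.toLinearMap

theorem minTmul_sum {ι : Type*} (s : Finset ι) (a : A) (f : ι → B) :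
    minTmul a (∑ i ∈ s, f i) = ∑ i ∈ s, minTmul a (f i) :=
  map_sum (minTmulₗ a) f s

theorem sum_minTmul {ι : Type*} (s : Finset ι) (f : ι → A) (b : B) :
    minTmul (∑ i ∈ s, f i) b = ∑ i ∈ s, minTmul (f i) b :=
  map_sum (minTmulₗ.flip b) f s

theorem minTmul_zero (a : A) : minTmul a (0 : B) = 0 := map_zero (minTmulₗ a)

theorem zero_minTmul (b : B) : minTmul (0 : A) b = 0 := map_zero (minTmulₗ.flip b)

theorem minSlice_mul_minTmul_one (τ : CStarState A) (x : MinTensor A B) (b : B) :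
    minSlice τ (x * minTmul 1 b) = minSlice τ x * b := by
  have : (minSlice τ).comp ((ContinuousLinearMap.mul ℂ _).flip (minTmul 1 b))
      = ((ContinuousLinearMap.mul ℂ B).flip b).comp (minSlice τ) := by
    refine MinTensor.clm_ext fun a d => ?_
    change minSlice τ (minTmul a d * minTmul 1 b) = minSlice τ (minTmul a d) * b
    rw [minTmul_mul, minSlice_minTmul, minSlice_minTmul, mul_one, smul_mul_assoc]
  exact congrArg (fun f : MinTensor A B →L[ℂ] B => f x) this

/-- Carries a commutation identity for `τ` over to `τ ⊗ id`: both sides are continuous in `x` and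
agree on elementary tensors. -/
theorem minSlice_mul_mul {τ : CStarState A} {a₁ a₂ a₃ : A} {c : ℂ}
    (h : ∀ a, τ (a₁ * a * a₂) = c * τ (a * a₃)) (b b' : B) (x : MinTensor A B) :
    minSlice τ (minTmul a₁ b * x * minTmul a₂ b')
      = c • (b * minSlice τ (x * minTmul a₃ 1) * b') := by
  have : (minSlice τ).comp (ContinuousLinearMap.mulLeftRight ℂ _ (minTmul a₁ b) (minTmul a₂ b'))
      = c • (ContinuousLinearMap.mulLeftRight ℂ B b b').comp
        ((minSlice τ).comp ((ContinuousLinearMap.mul ℂ _).flip (minTmul a₃ 1))) := by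
    refine MinTensor.clm_ext fun a d => ?_
    change minSlice τ (minTmul a₁ b * minTmul a d * minTmul a₂ b')
      = c • (b * minSlice τ (minTmul a d * minTmul a₃ 1) * b')
    rw [minTmul_mul, minTmul_mul, minSlice_minTmul, h, minTmul_mul, minSlice_minTmul, mul_one,
      mul_smul, mul_smul_comm, smul_mul_assoc]
  exact congrArg (fun f : MinTensor A B →L[ℂ] B => f x) this

end Slice

/-! ### Monomials in the generators of a graph algebra -/

/-- A *-homomorphism between C*-algebras as a continuous linear map. -/
def starHomCLM {A : Type*} {B : Type*} [CStarAlgebra A] [CStarAlgebra B] (π : A →⋆ₐ[ℂ] B) :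
    A →L[ℂ] B :=
  π.toAlgHom.toLinearMap.mkContinuous 1 fun a => by
    rw [one_mul]
    exact NonUnitalStarAlgHom.norm_apply_le π a

namespace Digraph

variable {V : Type u} [Fintype V] (Γ : Digraph V)

open scoped Classical in
theorem sum_S_mul_star_src (v : V) :
    ∑ e : Γ.Edge with e.src = v, Γ.S e * star (Γ.S e) = Γ.p v :=
  Γ.univFamily.range v

theorem sum_p : ∑ v, Γ.p v = 1 := Γ.univFamily.unit

theorem sum_S_mul_star : ∑ e, Γ.S e * star (Γ.S e) = 1 := by
  classical
  rw [← Γ.sum_p, ← Finset.sum_fiberwise Finset.univ Edge.src]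
  exact Finset.sum_congr rfl fun v _ => Γ.sum_S_mul_star_src v

/-- For `x = S_e p - S_e` with `p = S_e* S_e`, all four terms of `x* x` equal `p`, up to signs that
cancel. -/
theorem S_mul_p_tgt (e : Γ.Edge) : Γ.S e * Γ.p e.tgt = Γ.S e := by
  have hi : star (Γ.S e) * Γ.S e = Γ.p e.tgt := Γ.univFamily.initial e
  have hs : star (Γ.p e.tgt) = Γ.p e.tgt := Γ.univFamily.selfAdjoint _
  have hp : Γ.p e.tgt * Γ.p e.tgt = Γ.p e.tgt := Γ.univFamily.idem _
  rw [← sub_eq_zero, ← CStarRing.star_mul_self_eq_zero_iff, star_sub, star_mul, hs]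
  have h1 : Γ.p e.tgt * star (Γ.S e) * (Γ.S e * Γ.p e.tgt) = Γ.p e.tgt := by
    rw [mul_assoc, ← mul_assoc (star _), hi, hp, hp]
  have h2 : Γ.p e.tgt * star (Γ.S e) * Γ.S e = Γ.p e.tgt := by rw [mul_assoc, hi, hp]
  have h3 : star (Γ.S e) * (Γ.S e * Γ.p e.tgt) = Γ.p e.tgt := by rw [← mul_assoc, hi, hp]
  rw [sub_mul, mul_sub, mul_sub, h1, h2, h3, hi, sub_self]

theorem p_tgt_mul_star_S (e : Γ.Edge) : Γ.p e.tgt * star (Γ.S e) = star (Γ.S e) := by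
  conv_rhs => rw [← Γ.S_mul_p_tgt e, star_mul]
  congr 1
  exact (Γ.univFamily.selfAdjoint _).symm

/-- The range projections `S_e S_e*` sum to `1`, hence are orthogonal; multiplying their product by
`S_e*` on the left and `S_f` on the right recovers `S_e* S_f`. -/
theorem star_S_mul_S_of_ne {e f : Γ.Edge} (h : e ≠ f) : star (Γ.S e) * Γ.S f = 0 := by
  have h1 : Γ.S e * star (Γ.S e) * (Γ.S f * star (Γ.S f)) = 0 := by
    refine mul_eq_zero_of_sum_projections (q := fun e => Γ.S e * star (Γ.S e)) (fun e => ?_)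
      (fun e => ?_) Γ.sum_S_mul_star h
    · rw [star_mul, star_star]
    · rw [mul_assoc, ← mul_assoc (star _)]
      have hi : star (Γ.S e) * Γ.S e = Γ.p e.tgt := Γ.univFamily.initial e
      rw [hi, p_tgt_mul_star_S]
  have h2 : star (Γ.S e) * (Γ.S e * star (Γ.S e) * (Γ.S f * star (Γ.S f))) * Γ.S f
      = star (Γ.S e) * Γ.S f := by
    have hi : ∀ e, star (Γ.S e) * Γ.S e = Γ.p e.tgt := Γ.univFamily.initial
    calc _ = (star (Γ.S e) * Γ.S e) * star (Γ.S e) * (Γ.S f * (star (Γ.S f) * Γ.S f)) := by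
          simp only [mul_assoc]
      _ = _ := by rw [hi, hi, p_tgt_mul_star_S, S_mul_p_tgt]
  rw [← h2, h1, mul_zero, zero_mul]

open scoped Classical in
theorem star_S_mul_S (e f : Γ.Edge) :
    star (Γ.S e) * Γ.S f = if e = f then Γ.p e.tgt else 0 := by
  split_ifs with h
  · subst h
    exact Γ.univFamily.initial e
  · exact Γ.star_S_mul_S_of_ne h

open scoped Classical in
theorem p_mul_S (v : V) (e : Γ.Edge) : Γ.p v * Γ.S e = if e.src = v then Γ.S e else 0 := by
  rw [← sum_S_mul_star_src, Finset.sum_mul]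
  simp only [mul_assoc, star_S_mul_S, mul_ite, mul_zero, S_mul_p_tgt]
  rw [Finset.sum_ite_eq']
  simp

open scoped Classical in
theorem star_S_mul_p (v : V) (e : Γ.Edge) :
    star (Γ.S e) * Γ.p v = if e.src = v then star (Γ.S e) else 0 := by
  have hs : star (Γ.p v) = Γ.p v := Γ.univFamily.selfAdjoint v
  rw [← hs, ← star_mul, p_mul_S]
  split_ifs <;> simp

open scoped Classical in
theorem p_mul_p (v w : V) : Γ.p v * Γ.p w = if v = w then Γ.p v else 0 := by
  split_ifs with h
  · subst h
    exact Γ.univFamily.idem v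
  · exact Γ.univFamily.orthogonal v w h

theorem star_p (v : V) : star (Γ.p v) = Γ.p v := Γ.univFamily.selfAdjoint v

/-- The product of the `S_e` along a list of edges. -/
def pathS (μ : List Γ.Edge) : Γ.CStar := (μ.map Γ.S).prod

theorem pathS_nil : Γ.pathS [] = 1 := rfl

theorem pathS_cons (e : Γ.Edge) (μ : List Γ.Edge) : Γ.pathS (e :: μ) = Γ.S e * Γ.pathS μ := by
  simp [pathS]

theorem pathS_append (μ ν : List Γ.Edge) : Γ.pathS (μ ++ ν) = Γ.pathS μ * Γ.pathS ν := by
  simp [pathS]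

open scoped Classical in
theorem p_mul_pathS_cons (v : V) (e : Γ.Edge) (μ : List Γ.Edge) :
    Γ.p v * Γ.pathS (e :: μ) = if e.src = v then Γ.pathS (e :: μ) else 0 := by
  rw [pathS_cons, ← mul_assoc, p_mul_S]
  split_ifs <;> simp

/-- The linear span of the monomials `S_μ S_ν*`. -/
def monomialSpan : Submodule ℂ Γ.CStar :=
  Submodule.span ℂ {a | ∃ μ ν, a = Γ.pathS μ * star (Γ.pathS ν)}

theorem mul_mem_monomialSpan {x : Γ.CStar}
    (h : ∀ μ ν, x * (Γ.pathS μ * star (Γ.pathS ν)) ∈ Γ.monomialSpan) {y : Γ.CStar}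
    (hy : y ∈ Γ.monomialSpan) : x * y ∈ Γ.monomialSpan := by
  induction hy using Submodule.span_induction with
  | mem y hy =>
    obtain ⟨μ, ν, rfl⟩ := hy
    exact h μ ν
  | zero => rw [mul_zero]; exact zero_mem _
  | add y z _ _ hy hz => rw [mul_add]; exact add_mem hy hz
  | smul c y _ hy => rw [mul_smul_comm]; exact Submodule.smul_mem _ c hy

theorem monomial_mem (μ ν : List Γ.Edge) :
    Γ.pathS μ * star (Γ.pathS ν) ∈ Γ.monomialSpan := Submodule.subset_span ⟨μ, ν, rfl⟩

/-- The monomials contain no vertex letters, so for empty `μ` the projection is expanded as `p_v = ∑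
S_f S_f*` and the factor `S_f*` joins the adjoint path. -/
theorem p_mul_monomial_mem (v : V) (μ ν : List Γ.Edge) :
    Γ.p v * (Γ.pathS μ * star (Γ.pathS ν)) ∈ Γ.monomialSpan := by
  classical
  cases μ with
  | nil =>
    rw [← sum_S_mul_star_src, Finset.sum_mul]
    refine sum_mem fun f _ => ?_
    have : Γ.S f * star (Γ.S f) * (Γ.pathS [] * star (Γ.pathS ν))
        = Γ.pathS [f] * star (Γ.pathS (ν ++ [f])) := by
      rw [pathS_append]
      simp [pathS_cons, pathS_nil, mul_assoc]
    rw [this]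
    exact Γ.monomial_mem _ _
  | cons e μ =>
    rw [← mul_assoc, p_mul_pathS_cons]
    split_ifs
    · exact Γ.monomial_mem _ _
    · rw [zero_mul]; exact zero_mem _

theorem S_mul_monomial_mem (e : Γ.Edge) (μ ν : List Γ.Edge) :
    Γ.S e * (Γ.pathS μ * star (Γ.pathS ν)) ∈ Γ.monomialSpan := by
  rw [← mul_assoc, ← pathS_cons]
  exact Γ.monomial_mem _ _

theorem star_S_mul_monomial_mem (e : Γ.Edge) (μ ν : List Γ.Edge) :
    star (Γ.S e) * (Γ.pathS μ * star (Γ.pathS ν)) ∈ Γ.monomialSpan := by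
  classical
  cases μ with
  | nil =>
    have : star (Γ.S e) * (Γ.pathS [] * star (Γ.pathS ν))
        = Γ.pathS [] * star (Γ.pathS (ν ++ [e])) := by
      rw [pathS_append]
      simp [pathS_cons, pathS_nil]
    rw [this]
    exact Γ.monomial_mem _ _
  | cons f μ =>
    rw [pathS_cons, mul_assoc, ← mul_assoc, star_S_mul_S]
    split_ifs
    · exact Γ.p_mul_monomial_mem _ _ _
    · rw [zero_mul]; exact zero_mem _

/-- The span contains `1` and is stable under left multiplication by every generator and its
adjoint, so it contains the image of the free *-algebra. -/
theorem dense_monomialSpan : Dense (Γ.monomialSpan : Set Γ.CStar) := by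
  have key : ∀ x : FreeStarAlgebra (V ⊕ Γ.Edge), ∀ y ∈ Γ.monomialSpan,
      UniversalCStar.mk Γ.GraphRel x * y ∈ Γ.monomialSpan := by
    intro x
    induction x using FreeStarAlgebra.induction with
    | scalar c =>
      intro y hy
      have : UniversalCStar.mk Γ.GraphRel (algebraMap ℂ _ c) = algebraMap ℂ _ c :=
        AlgHomClass.commutes (UniversalCStar.mk Γ.GraphRel) c
      rw [this, ← Algebra.smul_def]
      exact Submodule.smul_mem _ c hy
    | letter x =>
      intro y hy
      rcases x with (v | e) | (v | e)
      · exact Γ.mul_mem_monomialSpan (Γ.p_mul_monomial_mem v) hy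
      · exact Γ.mul_mem_monomialSpan (Γ.S_mul_monomial_mem e) hy
      · have : UniversalCStar.mk Γ.GraphRel (FreeStarAlgebra.letter (Sum.inr (Sum.inl v)))
            = star (Γ.p v) := by
          change _ = star (UniversalCStar.mk Γ.GraphRel (FreeStarAlgebra.letter _))
          rw [← map_star, FreeStarAlgebra.star_letter, Sum.swap_inl]
        rw [this, star_p]
        exact Γ.mul_mem_monomialSpan (Γ.p_mul_monomial_mem v) hy
      · have : UniversalCStar.mk Γ.GraphRel (FreeStarAlgebra.letter (Sum.inr (Sum.inr e)))
            = star (Γ.S e) := by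
          change _ = star (UniversalCStar.mk Γ.GraphRel (FreeStarAlgebra.letter _))
          rw [← map_star, FreeStarAlgebra.star_letter, Sum.swap_inl]
        rw [this]
        exact Γ.mul_mem_monomialSpan (Γ.star_S_mul_monomial_mem e) hy
    | mul a b ha hb =>
      intro y hy
      rw [map_mul, mul_assoc]
      exact ha _ (hb _ hy)
    | add a b ha hb =>
      intro y hy
      rw [map_add, add_mul]
      exact add_mem (ha _ hy) (hb _ hy)
  have hone : (1 : Γ.CStar) ∈ Γ.monomialSpan := by
    simpa [pathS_nil] using Γ.monomial_mem [] []
  refine Dense.mono ?_ (universalSeminorm Γ.GraphRel).denseRange_toCompletion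
  rintro _ ⟨x, rfl⟩
  have := key x 1 hone
  rwa [mul_one] at this

/-- Continuous linear maps on a graph algebra which agree on the monomials are equal. -/
theorem ext_monomial {E : Type*} [NormedAddCommGroup E] [NormedSpace ℂ E] {f g : Γ.CStar →L[ℂ] E}
    (h : ∀ μ ν, f (Γ.pathS μ * star (Γ.pathS ν)) = g (Γ.pathS μ * star (Γ.pathS ν))) : f = g := by
  refine ContinuousLinearMap.ext_on Γ.dense_monomialSpan ?_
  rintro _ ⟨μ, ν, rfl⟩
  exact h μ ν

/-! ### Homogeneous elements -/

variable {Γ} in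
/-- `a` is homogeneous of degree `n` for the gauge action. -/
def IsHomogeneous (n : ℤ) (a : Γ.CStar) : Prop :=
  ∀ t : ℝ, Γ.dynamics t a = Complex.exp (Complex.I * n * t) • a

theorem dynamics_p (t : ℝ) (v : V) : Γ.dynamics t (Γ.p v) = Γ.p v := CKFamily.lift_p _ v

theorem dynamics_S (t : ℝ) (e : Γ.Edge) :
    Γ.dynamics t (Γ.S e) = Complex.exp (t * Complex.I) • Γ.S e := by
  refine (CKFamily.lift_S _ e).trans ?_
  exact congrArg (fun z : ℂ => z • Γ.S e) (Circle.coe_exp t)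

variable {Γ}

namespace IsHomogeneous

theorem p (v : V) : IsHomogeneous 0 (Γ.p v) := fun t => by simp [dynamics_p]

theorem one : IsHomogeneous 0 (1 : Γ.CStar) := fun t => by simp

theorem S (e : Γ.Edge) : IsHomogeneous 1 (Γ.S e) := fun t => by
  rw [dynamics_S]
  congr 2
  push_cast
  ring

theorem mul {m n : ℤ} {a b : Γ.CStar} (ha : IsHomogeneous m a) (hb : IsHomogeneous n b) :
    IsHomogeneous (m + n) (a * b) := fun t => by
  rw [map_mul, ha, hb, smul_mul_smul_comm, ← Complex.exp_add]
  congr 2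
  push_cast
  ring

theorem star {n : ℤ} {a : Γ.CStar} (ha : IsHomogeneous n a) : IsHomogeneous (-n) (star a) :=
  fun t => by
    rw [map_star, ha, star_smul]
    congr 1
    rw [Complex.star_def, ← Complex.exp_conj]
    congr 1
    simp

theorem pathS (μ : List Γ.Edge) : IsHomogeneous μ.length (Γ.pathS μ) := by
  induction μ with
  | nil => simpa [pathS_nil] using one
  | cons e μ ih =>
    rw [pathS_cons, List.length_cons, Nat.cast_succ, add_comm]
    exact (S e).mul ih

theorem monomial (μ ν : List Γ.Edge) :
    IsHomogeneous (μ.length - ν.length) (Γ.pathS μ * Star.star (Γ.pathS ν)) := by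
  rw [sub_eq_add_neg]
  exact (pathS μ).mul (pathS ν).star

end IsHomogeneous

theorem dynamics_add (s t : ℝ) (a : Γ.CStar) :
    Γ.dynamics (s + t) a = Γ.dynamics s (Γ.dynamics t a) := by
  have : starHomCLM (Γ.dynamics (s + t))
      = (starHomCLM (Γ.dynamics s)).comp (starHomCLM (Γ.dynamics t)) := by
    refine Γ.ext_monomial fun μ ν => ?_
    change Γ.dynamics _ _ = Γ.dynamics _ (Γ.dynamics _ _)
    have hh := IsHomogeneous.monomial μ ν
    rw [hh, hh t, map_smul, hh, smul_smul, ← Complex.exp_add]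
    congr 2
    push_cast
    ring
  exact congrArg (fun f : Γ.CStar →L[ℂ] Γ.CStar => f a) this

/-- Irrationality of `π`. Thanks to it, invariance under the time-one map alone detects the degree.
-/
theorem exp_I_mul_intCast_ne_one {n : ℤ} (hn : n ≠ 0) : Complex.exp (Complex.I * n) ≠ 1 := by
  rw [Ne, Complex.exp_eq_one_iff]
  rintro ⟨k, hk⟩
  have h1 : (n : ℂ) = k * (2 * Real.pi) := by
    have := Complex.I_ne_zero
    refine mul_left_cancel₀ this ?_
    rw [hk]
    ring
  have h2 : (n : ℝ) = k * (2 * Real.pi) := by exact_mod_cast h1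
  have hk0 : k ≠ 0 := by
    rintro rfl
    simp at h2
    exact hn h2
  refine irrational_pi ⟨n / (2 * k), ?_⟩
  have : (k : ℝ) ≠ 0 := by exact_mod_cast hk0
  push_cast
  field_simp
  linarith

/-- A functional invariant under one irrational rotation vanishes on the homogeneous elements of
nonzero degree. -/
theorem IsHomogeneous.apply_eq_zero {n : ℤ} {a : Γ.CStar} (ha : IsHomogeneous n a) (hn : n ≠ 0)
    {φ : Γ.CStar →L[ℂ] ℂ} (h : φ (Γ.dynamics 1 a) = φ a) : φ a = 0 := by
  rw [ha, map_smul, smul_eq_mul, Complex.ofReal_one, mul_one] at h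
  by_contra h0
  exact exp_I_mul_intCast_ne_one hn ((mul_eq_right₀ h0).1 h)

/-- A functional which is invariant under one irrational rotation is gauge-invariant. -/
theorem apply_dynamics_eq {φ : Γ.CStar →L[ℂ] ℂ} (h : ∀ a, φ (Γ.dynamics 1 a) = φ a) (t : ℝ)
    (a : Γ.CStar) : φ (Γ.dynamics t a) = φ a := by
  have : φ.comp (starHomCLM (Γ.dynamics t)) = φ := by
    refine Γ.ext_monomial fun μ ν => ?_
    change φ (Γ.dynamics t _) = _
    have hh := IsHomogeneous.monomial μ ν
    rcases eq_or_ne ((μ.length : ℤ) - ν.length) 0 with h0 | h0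
    · rw [hh, h0]
      simp
    · rw [hh, map_smul, hh.apply_eq_zero h0 (h _), smul_zero]
  exact congrArg (fun f : Γ.CStar →L[ℂ] ℂ => f a) this

/-! ### Conformal functionals -/

/-- The commutation relations of a KMS functional, `c = e^{-β}`. -/
structure IsConformal (c : ℂ) (φ : Γ.CStar →L[ℂ] ℂ) : Prop where
  S_mul : ∀ (e : Γ.Edge) (a : Γ.CStar), φ (Γ.S e * a) = c * φ (a * Γ.S e)
  mul_star_S : ∀ (e : Γ.Edge) (a : Γ.CStar), φ (a * star (Γ.S e)) = c * φ (star (Γ.S e) * a)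
  invariant : ∀ (t : ℝ) (a : Γ.CStar), φ (Γ.dynamics t a) = φ a

namespace IsConformal

variable {c : ℂ} {φ ψ : Γ.CStar →L[ℂ] ℂ}

theorem sub (hφ : IsConformal c φ) (hψ : IsConformal c ψ) : IsConformal c (φ - ψ) where
  S_mul e a := by simp [hφ.S_mul, hψ.S_mul, mul_sub]
  mul_star_S e a := by simp [hφ.mul_star_S, hψ.mul_star_S, mul_sub]
  invariant t a := by simp [hφ.invariant, hψ.invariant]

theorem pathS_mul (hφ : IsConformal c φ) (μ : List Γ.Edge) (a : Γ.CStar) :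
    φ (Γ.pathS μ * a) = c ^ μ.length * φ (a * Γ.pathS μ) := by
  induction μ generalizing a with
  | nil => simp [pathS_nil]
  | cons e μ ih =>
    rw [pathS_cons, mul_assoc, hφ.S_mul, mul_assoc, ih, List.length_cons, pow_succ', mul_assoc,
      mul_assoc]

theorem mul_star_pathS (hφ : IsConformal c φ) (μ : List Γ.Edge) (a : Γ.CStar) :
    φ (a * star (Γ.pathS μ)) = c ^ μ.length * φ (star (Γ.pathS μ) * a) := by
  induction μ generalizing a with
  | nil => simp [pathS_nil]
  | cons e μ ih =>
    rw [pathS_cons, star_mul, ← mul_assoc, hφ.mul_star_S, ← mul_assoc, ih, List.length_cons,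
      pow_succ', mul_assoc, mul_assoc (star _)]

/-- Powers of `c` stand on both sides so that no division by `c` is needed. -/
theorem monomial_mul (hφ : IsConformal c φ) (μ ν : List Γ.Edge) (a : Γ.CStar) :
    c ^ ν.length * φ (Γ.pathS μ * star (Γ.pathS ν) * a)
      = c ^ μ.length * φ (a * (Γ.pathS μ * star (Γ.pathS ν))) := by
  rw [mul_assoc, hφ.pathS_mul, ← mul_assoc a, hφ.mul_star_pathS, mul_left_comm, mul_assoc (star _)]

end IsConformal

/-- Equal lengths let `S_ν* S_μ` collapse from the inside: the first edges must agree and leave a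
vertex projection, which the next edge absorbs or annihilates. A span is needed because the empty
path gives `1 = ∑ p_v`. -/
theorem star_pathS_mul_pathS_mem (μ ν : List Γ.Edge) (h : ν.length = μ.length) :
    star (Γ.pathS ν) * Γ.pathS μ ∈ Submodule.span ℂ (Set.range Γ.p) := by
  classical
  induction μ generalizing ν with
  | nil =>
    obtain rfl := List.length_eq_zero_iff.1 h
    rw [pathS_nil, star_one, mul_one, ← sum_p]
    exact sum_mem fun v _ => Submodule.subset_span ⟨v, rfl⟩
  | cons e μ ih =>
    obtain _ | ⟨f, ν⟩ := ν
    · simp at h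
    have h' : ν.length = μ.length := by simpa using h
    have : star (Γ.pathS (f :: ν)) * Γ.pathS (e :: μ)
        = star (Γ.pathS ν) * ((star (Γ.S f) * Γ.S e) * Γ.pathS μ) := by
      simp [pathS_cons, mul_assoc]
    rw [this, star_S_mul_S]
    split_ifs
    · cases μ with
      | nil =>
        obtain rfl := List.length_eq_zero_iff.1 h'
        rw [pathS_nil, star_one, mul_one, one_mul]
        exact Submodule.subset_span ⟨_, rfl⟩
      | cons g μ =>
        rw [p_mul_pathS_cons]
        split_ifs
        · exact ih ν h'
        · rw [mul_zero]; exact zero_mem _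
    · rw [zero_mul, mul_zero]; exact zero_mem _

/-- A conformal functional is determined by its values on the vertex projections. -/
theorem IsConformal.eq_zero {c : ℂ} {φ : Γ.CStar →L[ℂ] ℂ} (hφ : IsConformal c φ)
    (h : ∀ v, φ (Γ.p v) = 0) : φ = 0 := by
  refine Γ.ext_monomial fun μ ν => ?_
  rw [zero_apply]
  rcases eq_or_ne ((μ.length : ℤ) - ν.length) 0 with h0 | h0
  · rw [hφ.pathS_mul]
    have hle : Submodule.span ℂ (Set.range Γ.p) ≤ LinearMap.ker φ.toLinearMap := by
      rw [Submodule.span_le]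
      rintro _ ⟨v, rfl⟩
      exact h v
    have := hle (star_pathS_mul_pathS_mem μ ν (by omega))
    rw [LinearMap.mem_ker] at this
    rw [show φ (star (Γ.pathS ν) * Γ.pathS μ) = 0 from this, mul_zero]
  · exact (IsHomogeneous.monomial μ ν).apply_eq_zero h0 (hφ.invariant 1 _)

theorem IsConformal.ext {c : ℂ} {φ ψ : Γ.CStar →L[ℂ] ℂ} (hφ : IsConformal c φ)
    (hψ : IsConformal c ψ) (h : ∀ v, φ (Γ.p v) = ψ (Γ.p v)) : φ = ψ :=
  sub_eq_zero.1 ((hφ.sub hψ).eq_zero fun v => by simp [h])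

/-! ### KMS states -/

/-- Homogeneous elements are entire, with `σ_z(a) = e^{inz} a`; at `z = iβ` the factor is `e^{-nβ}`.
The relations are the cases `n = 1` and `n = -1`. -/
theorem IsKMS.isConformal {β : ℝ} {τ : CStarState Γ.CStar} (h : Γ.IsKMS β τ) :
    IsConformal (Complex.exp (-β)) τ.toCLM := by
  have key : ∀ {n : ℤ} {a : Γ.CStar} (_ : IsHomogeneous n a) (b : Γ.CStar),
      τ (a * b) = Complex.exp (-β) ^ n * τ (b * a) := fun {n a} ha b => by
    have := h.2 a b (fun z => Complex.exp (Complex.I * n * z) • a) (by fun_prop)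
      (fun t => (ha t).symm)
    rw [this, mul_smul_comm, map_smul, smul_eq_mul, ← Complex.exp_int_mul]
    congr 2
    have := Complex.I_sq
    linear_combination (n * β : ℂ) * this
  refine ⟨fun e a => ?_, fun e a => ?_, h.1⟩
  · have := key (IsHomogeneous.S e) a
    rwa [zpow_one] at this
  · have := key (IsHomogeneous.S e).star a
    change τ _ = _ * τ _
    rw [this, zpow_neg, zpow_one, ← mul_assoc, mul_inv_cancel₀ (Complex.exp_ne_zero _), one_mul]

/-- By density it suffices to test an arbitrary entire `a` against a monomial `b` of degree `n`.
Invariance determines `τ(σ_t(a) b)` for real `t`, analytic continuation carries this to `iβ`, and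
`monomial_mul` then exchanges `b` with `σ_{iβ}(a)`. -/
theorem isKMS_of_isConformal {β : ℝ} {τ : CStarState Γ.CStar}
    (h : IsConformal (Complex.exp (-β)) τ.toCLM) : Γ.IsKMS β τ := by
  refine ⟨h.invariant, fun a b f hf hfa => ?_⟩
  suffices hs : (τ.toCLM.comp (ContinuousLinearMap.mul ℂ Γ.CStar a))
      = τ.toCLM.comp ((ContinuousLinearMap.mul ℂ Γ.CStar).flip (f (Complex.I * β))) from
    congrArg (fun g : Γ.CStar →L[ℂ] ℂ => g b) hs
  refine Γ.ext_monomial fun μ ν => ?_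
  obtain ⟨b, hb⟩ : ∃ b, b = Γ.pathS μ * star (Γ.pathS ν) := ⟨_, rfl⟩
  obtain ⟨n, hn⟩ : ∃ n : ℤ, n = μ.length - ν.length := ⟨_, rfl⟩
  have hhom : IsHomogeneous n b := by
    rw [hn, hb]
    exact IsHomogeneous.monomial μ ν
  have hcomm := h.monomial_mul μ ν (f (Complex.I * β))
  rw [← hb] at hcomm ⊢
  change τ.toCLM (a * b) = τ.toCLM (b * f (Complex.I * β))
  have hentire : ∀ z : ℂ, τ.toCLM (f z * b)
      = Complex.exp (-(Complex.I * n * z)) * τ.toCLM (a * b) := by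
    have h1 : Differentiable ℂ fun z => τ.toCLM (f z * b) :=
      τ.toCLM.differentiable.comp (hf.mul_const b)
    have h2 : Differentiable ℂ fun z : ℂ =>
        Complex.exp (-(Complex.I * n * z)) * τ.toCLM (a * b) := by fun_prop
    have hreal : ∀ t : ℝ, τ.toCLM (f t * b)
        = Complex.exp (-(Complex.I * n * t)) * τ.toCLM (a * b) := fun t => by
      have h3 : Γ.dynamics t (a * b) = Complex.exp (Complex.I * n * t) • (f t * b) := by
        rw [map_mul, hhom t, hfa, mul_smul_comm]
      have h4 := h.invariant t (a * b)
      rw [h3, map_smul, smul_eq_mul] at h4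
      rw [← h4, ← mul_assoc, ← Complex.exp_add, neg_add_cancel, Complex.exp_zero, one_mul]
    -- The real points accumulate at `0`, so the identity theorem applies to the two entire
    -- functions.
    have h5 : Filter.Tendsto (fun t : ℝ => (t : ℂ)) (nhdsWithin 0 {0}ᶜ) (nhdsWithin 0 {0}ᶜ) := by
      refine tendsto_nhdsWithin_iff.2 ⟨?_, ?_⟩
      · exact (Complex.continuous_ofReal.tendsto' 0 0 Complex.ofReal_zero).mono_left
          nhdsWithin_le_nhds
      · filter_upwards [self_mem_nhdsWithin] with t ht
        simpa using ht
    refine fun z => congrFun (AnalyticOnNhd.eq_of_frequently_eq (z₀ := 0)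
      (f := fun z => τ.toCLM (f z * b))
      (g := fun z : ℂ => Complex.exp (-(Complex.I * n * z)) * τ.toCLM (a * b))
      (fun z _ => h1.analyticAt z) (fun z _ => h2.analyticAt z) ?_) z
    exact h5.frequently (Filter.Frequently.of_forall hreal)
  have hexp : Complex.exp (-(β : ℂ)) ^ μ.length * Complex.exp (-(Complex.I * n * (Complex.I * β)))
      = Complex.exp (-(β : ℂ)) ^ ν.length := by
    rw [← Complex.exp_nat_mul, ← Complex.exp_nat_mul, ← Complex.exp_add, hn]
    congr 1
    push_cast
    linear_combination (-(μ.length - ν.length : ℂ) * β) * Complex.I_sq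
  rw [hentire, ← mul_assoc, hexp] at hcomm
  exact (mul_left_cancel₀ (pow_ne_zero _ (Complex.exp_ne_zero _)) hcomm).symm

end Digraph

/-! ### Partial permutations as operators on `ℓ²` -/

section PartialPermutation

variable {I : Type u}

/-- A partial permutation is injective where defined, so the left side is a partial sum of the
series of squares of `x`. -/
theorem sum_norm_elim_le (f : I ≃. I) (x : lp (fun _ : I => ℂ) 2) (s : Finset I) :
    ∑ i ∈ s, ‖(f i).elim 0 x‖ ^ (2 : ENNReal).toReal ≤ ‖x‖ ^ (2 : ENNReal).toReal := by
  classical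
  have h2 : 0 < (2 : ENNReal).toReal := by norm_num
  let g : I → I := fun i => (f i).getD i
  let s' := s.filter fun i => (f i).isSome
  have hg : ∀ i ∈ s', f i = some (g i) := fun i hi => by
    obtain ⟨j, hj⟩ := Option.isSome_iff_exists.1 (Finset.mem_filter.1 hi).2
    simp [g, hj]
  have h : ∑ i ∈ s, ‖(f i).elim 0 x‖ ^ (2 : ENNReal).toReal
      = ∑ i ∈ s', ‖x (g i)‖ ^ (2 : ENNReal).toReal := by
    rw [Finset.sum_filter]
    refine Finset.sum_congr rfl fun i _ => ?_
    cases hi : f i <;> simp [g, hi]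
  have hinj : Set.InjOn g s' := fun i hi j hj hij =>
    f.inj (b := g i) (hg i hi) (by rw [hij]; exact hg j hj)
  rw [h, ← Finset.sum_image (f := fun j => ‖x j‖ ^ (2 : ENNReal).toReal) hinj]
  exact lp.sum_rpow_le_norm_rpow h2 x _

/-- The operator on `ℓ²` given by a partial permutation of the index set. -/
def partialPermOp (f : I ≃. I) : lp (fun _ : I => ℂ) 2 →L[ℂ] lp (fun _ : I => ℂ) 2 :=
  LinearMap.mkContinuous
    { toFun := fun x => ⟨fun i => (f i).elim 0 x, memℓp_gen' (sum_norm_elim_le f x)⟩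
      map_add' := fun x y => by
        ext i
        change (f i).elim 0 (fun j => x j + y j) = (f i).elim (0 : ℂ) x + (f i).elim (0 : ℂ) y
        cases f i <;> simp
      map_smul' := fun c x => by
        ext i
        change (f i).elim 0 (c • x) = c • (f i).elim (0 : ℂ) x
        cases f i <;> simp } 1
    (fun x => by
      rw [one_mul]
      exact lp.norm_le_of_forall_sum_le (by norm_num) (norm_nonneg x) (sum_norm_elim_le f x))

theorem partialPermOp_apply (f : I ≃. I) (x : lp (fun _ : I => ℂ) 2) (i : I) :
    partialPermOp f x i = (f i).elim 0 x := rfl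

theorem partialPermOp_mul (f g : I ≃. I) :
    partialPermOp f * partialPermOp g = partialPermOp (f.trans g) := by
  ext x i
  change (f i).elim 0 (fun j => (g j).elim 0 x) = ((f i).bind g).elim 0 x
  cases f i <;> rfl

theorem star_partialPermOp (f : I ≃. I) : star (partialPermOp f) = partialPermOp f.symm := by
  symm
  rw [ContinuousLinearMap.star_eq_adjoint, ContinuousLinearMap.eq_adjoint_iff]
  intro x y
  rw [lp.inner_eq_tsum, lp.inner_eq_tsum]
  have hs : ∀ j, ⟪x j, partialPermOp f y j⟫_ℂ ≠ 0 → f j = some ((f j).getD j) := fun j hj => by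
    rw [partialPermOp_apply] at hj
    cases h : f j with
    | none => simp [h] at hj
    | some k => simp
  refine tsum_eq_tsum_of_ne_zero_bij (fun j => (f j.1).getD j.1) ?_ ?_ ?_
  · rintro ⟨j, hj⟩ ⟨k, hk⟩ hjk
    have hk' := hs k hk
    simp only at hjk
    rw [← hjk] at hk'
    exact Subtype.ext (f.inj (hs j hj) hk')
  · intro i hi
    rw [Function.mem_support, partialPermOp_apply] at hi
    cases h : f.symm i with
    | none => simp [h] at hi
    | some j =>
      have hj : f j = some i := (f.eq_some_iff).1 h
      refine ⟨⟨j, ?_⟩, ?_⟩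
      · rw [Function.mem_support, partialPermOp_apply, hj]
        simpa [h] using hi
      · simp [hj]
  · rintro ⟨j, hj⟩
    have h1 := hs j hj
    have h2 := (f.eq_some_iff).2 h1
    simp only [partialPermOp_apply]
    rw [h2]
    conv_rhs => rw [h1]
    rfl

end PartialPermutation

namespace Digraph

/-! ### The representation on the space of infinite paths -/

section InfinitePaths

variable {V : Type u} (Γ : Digraph V)

/-- The infinite paths. -/
@[ext]
structure InfPath where
  /-- The edges of the path. -/
  edge : ℕ → Γ.Edge
  tgt_edge : ∀ n, (edge n).tgt = (edge (n + 1)).src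

variable {Γ}

namespace InfPath

/-- The path without its first edge. -/
def tail (x : Γ.InfPath) : Γ.InfPath := ⟨fun n => x.edge (n + 1), fun n => x.tgt_edge (n + 1)⟩

/-- The path with an additional first edge. -/
def cons (e : Γ.Edge) (x : Γ.InfPath) (h : (x.edge 0).src = e.tgt) : Γ.InfPath :=
  ⟨fun n => n.casesOn e x.edge, fun n => by cases n with
    | zero => exact h.symm
    | succ n => exact x.tgt_edge n⟩

/-- Without sinks an outgoing edge can be chosen at every vertex and followed forever. -/
theorem exists_src (h : Γ.NoSinks) (v : V) : ∃ x : Γ.InfPath, (x.edge 0).src = v := by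
  choose out hout using h
  let w : ℕ → V := fun n => n.rec v fun _ z => (out z).tgt
  exact ⟨⟨fun n => out (w n), fun n => (hout (w (n + 1))).symm⟩, hout v⟩

open scoped Classical in
/-- The partial permutation of infinite paths that strips the first edge `e`. -/
def strip (e : Γ.Edge) : Γ.InfPath ≃. Γ.InfPath where
  toFun x := if x.edge 0 = e then some x.tail else none
  invFun x := if h : (x.edge 0).src = e.tgt then some (cons e x h) else none
  inv x y := by
    constructor
    · intro h
      by_cases hy : (y.edge 0).src = e.tgt
      · rw [dif_pos hy] at h
        obtain rfl := Option.mem_some.1 h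
        exact if_pos rfl
      · rw [dif_neg hy] at h
        exact absurd h (by simp)
    · intro h
      by_cases hx : x.edge 0 = e
      · rw [if_pos hx] at h
        obtain rfl := Option.mem_some.1 h
        have hs : (x.tail.edge 0).src = e.tgt := by rw [← hx]; exact (x.tgt_edge 0).symm
        rw [dif_pos hs]
        refine Option.mem_some.2 (InfPath.ext (funext fun n => ?_))
        cases n with
        | zero => exact hx.symm
        | succ n => rfl
      · rw [if_neg hx] at h
        exact absurd h (by simp)

open scoped Classical in
/-- The coordinate projection onto the paths starting at `v`. -/
def proj (v : V) : lp (fun _ : Γ.InfPath => ℂ) 2 →L[ℂ] lp (fun _ : Γ.InfPath => ℂ) 2 :=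
  partialPermOp (PEquiv.ofSet {x | (x.edge 0).src = v})

open scoped Classical in
theorem proj_apply (v : V) (u : lp (fun _ : Γ.InfPath => ℂ) 2) (x : Γ.InfPath) :
    proj v u x = if (x.edge 0).src = v then u x else 0 := by
  rw [proj, partialPermOp_apply]
  change (if (x.edge 0).src = v then some x else none : Option _).elim 0 u = _
  split_ifs <;> rfl

open scoped Classical in
theorem partialPermOp_strip_mul_star (e : Γ.Edge) (u : lp (fun _ : Γ.InfPath => ℂ) 2)
    (x : Γ.InfPath) :
    (partialPermOp (strip e) * star (partialPermOp (strip e))) u x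
      = if x.edge 0 = e then u x else 0 := by
  rw [star_partialPermOp, partialPermOp_mul, PEquiv.self_trans_symm, partialPermOp_apply]
  by_cases hx : x.edge 0 = e
  · have : PEquiv.ofSet {a | (strip e a).isSome = true} x = some x := by
      rw [PEquiv.ofSet_eq_some_self_iff]
      change (if x.edge 0 = e then some x.tail else none).isSome = true
      rw [if_pos hx]
      rfl
    rw [this, if_pos hx]
    rfl
  · have : PEquiv.ofSet {a | (strip e a).isSome = true} x = none := by
      refine if_neg ?_
      change ¬ (if x.edge 0 = e then some x.tail else none).isSome = true
      rw [if_neg hx]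
      simp
    rw [this, if_neg hx]
    rfl

theorem star_mul_partialPermOp_strip (e : Γ.Edge) :
    star (partialPermOp (strip e)) * partialPermOp (strip e) = proj e.tgt := by
  classical
  rw [star_partialPermOp, partialPermOp_mul, PEquiv.symm_trans_self, proj]
  congr 1
  have : {b : Γ.InfPath | ((strip e).symm b).isSome = true} = {x | (x.edge 0).src = e.tgt} := by
    ext x
    change (if h : (x.edge 0).src = e.tgt then some (cons e x h) else none).isSome = true ↔ _
    by_cases hx : (x.edge 0).src = e.tgt <;> simp [hx]
  simp only [this]

/-- The Cuntz-Krieger family on the space of infinite paths. -/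
def family [Fintype V] : Γ.CKFamily (lp (fun _ : Γ.InfPath => ℂ) 2 →L[ℂ] lp (fun _ : Γ.InfPath => ℂ) 2) where
  p := proj
  -- Operators act by pullback, so stripping `e` from the argument sends the basis vector at `y` to
  -- the one at `e y`, or to zero when `e` cannot precede `y`.
  S e := partialPermOp (strip e)
  idem v := by
    ext u x
    change proj v (proj v u) x = _
    rw [proj_apply, proj_apply]
    split_ifs <;> rfl
  selfAdjoint v := by rw [proj, star_partialPermOp, PEquiv.ofSet_symm]
  orthogonal v w h := by
    ext u x
    change proj v (proj w u) x = 0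
    rw [proj_apply, proj_apply]
    split_ifs with h1 h2
    · exact absurd (h1.symm.trans h2) h
    · rfl
    · rfl
  unit := by
    classical
    ext u x
    rw [sum_apply, lp.coeFn_sum, Finset.sum_apply]
    simp only [proj_apply]
    simp
  initial := star_mul_partialPermOp_strip
  range v := by
    classical
    ext u x
    rw [sum_apply, lp.coeFn_sum, Finset.sum_apply, proj_apply]
    simp only [partialPermOp_strip_mul_star]
    rw [Finset.sum_ite_eq]
    simp

end InfPath

end InfinitePaths

variable {V : Type u} [Fintype V] {Γ : Digraph V}

/-! ### Existence of a conformal state -/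

open scoped Classical in
-- Averages the vector states of the basis vectors of one infinite path from each vertex; `p_v`
-- fixes exactly one of these vectors and kills the others.
theorem exists_state_apply_p [Nonempty V] (h : Γ.NoSinks) :
    ∃ τ : CStarState Γ.CStar, ∀ v, τ (Γ.p v) = 1 / (Fintype.card V : ℂ) := by
  choose x hx using InfPath.exists_src h
  let ξ : V → lp (fun _ : Γ.InfPath => ℂ) 2 := fun v => lp.single 2 (x v) 1
  have hξ : ∀ v, ‖ξ v‖ = 1 := fun v => by
    rw [lp.norm_single (by norm_num)]
    exact norm_one
  let π := (InfPath.family (Γ := Γ)).lift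
  have hm : (Fintype.card V : ℂ) ≠ 0 := by exact_mod_cast Fintype.card_ne_zero
  let φ : Γ.CStar →ₗ[ℂ] ℂ :=
    { toFun := fun a => (1 / (Fintype.card V : ℂ)) * ∑ v, ⟪ξ v, π a (ξ v)⟫_ℂ
      map_add' := fun a b => by
        simp only [map_add, add_apply, inner_add_right, Finset.sum_add_distrib, mul_add]
      map_smul' := fun c a => by
        simp only [map_smul, smul_apply, inner_smul_right, ← Finset.mul_sum,
          RingHom.id_apply, smul_eq_mul]
        ring }
  refine ⟨CStarState.ofLinear φ ?_ ?_, fun v => ?_⟩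
  · change (1 / (Fintype.card V : ℂ)) * ∑ v, ⟪ξ v, π 1 (ξ v)⟫_ℂ = 1
    have : ∀ v, ⟪ξ v, π 1 (ξ v)⟫_ℂ = 1 := fun v => by
      rw [map_one, one_apply_eq_self, inner_self_eq_norm_sq_to_K, hξ]
      simp
    rw [Finset.sum_congr rfl fun v _ => this v]
    simp [hm]
  · intro b
    refine mul_nonneg (by positivity) (Finset.sum_nonneg fun v _ => ?_)
    rw [map_mul, map_star, ContinuousLinearMap.star_eq_adjoint]
    change 0 ≤ ⟪ξ v, ContinuousLinearMap.adjoint (π b) (π b (ξ v))⟫_ℂ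
    rw [ContinuousLinearMap.adjoint_inner_right, inner_self_eq_norm_sq_to_K]
    exact pow_nonneg (by simp) 2
  · change (1 / (Fintype.card V : ℂ)) * ∑ w, ⟪ξ w, π (Γ.p v) (ξ w)⟫_ℂ = _
    have : ∀ w, ⟪ξ w, π (Γ.p v) (ξ w)⟫_ℂ = if w = v then 1 else 0 := fun w => by
      have hp : π (Γ.p v) = InfPath.proj v := CKFamily.lift_p _ v
      rw [hp, lp.inner_single_left, InfPath.proj_apply, hx]
      split_ifs <;> simp [ξ]
    rw [Finset.sum_congr rfl fun w _ => this w]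
    simp

/-- The dual transfer operator `τ ↦ c ∑ τ(S_e* · S_e)` on functionals. -/
def transfer (c : ℂ) (τ : CStarState Γ.CStar) : Γ.CStar →ₗ[ℂ] ℂ where
  toFun a := c * ∑ e, τ (star (Γ.S e) * a * Γ.S e)
  map_add' a b := by
    simp only [mul_add, add_mul, map_add, Finset.sum_add_distrib]
  map_smul' d a := by
    simp only [mul_smul_comm, smul_mul_assoc, map_smul, smul_eq_mul, ← Finset.mul_sum,
      RingHom.id_apply]
    ring

theorem transfer_apply (c : ℂ) (τ : CStarState Γ.CStar) (a : Γ.CStar) :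
    transfer c τ a = c * ∑ e, τ (star (Γ.S e) * a * Γ.S e) := rfl

open scoped Classical in
-- Here the constant out-degree enters: `lam` edges leave `v`, each contributing `k`, which cancels
-- the factor `lam⁻¹`.
theorem transfer_apply_p {lam : ℕ} (hlam : 0 < lam)
    (hrow : ∀ v, (Finset.univ.filter fun e : Γ.Edge => e.src = v).card = lam)
    {τ : CStarState Γ.CStar} {k : ℂ} (hτ : ∀ v, τ (Γ.p v) = k) (v : V) :
    transfer (lam : ℂ)⁻¹ τ (Γ.p v) = k := by
  have h : ∀ e, τ (star (Γ.S e) * Γ.p v * Γ.S e) = if e.src = v then k else 0 := fun e => by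
    rw [mul_assoc, p_mul_S]
    split_ifs
    · rw [star_S_mul_S, if_pos rfl, hτ]
    · rw [mul_zero, map_zero]
  have hl : (lam : ℂ) ≠ 0 := by exact_mod_cast hlam.ne'
  rw [transfer_apply]
  simp only [h]
  rw [← Finset.sum_filter, Finset.sum_const, hrow, nsmul_eq_mul, ← mul_assoc, inv_mul_cancel₀ hl,
    one_mul]

/-- A fixed point of the dual transfer operator satisfies the KMS relations. -/
theorem S_mul_of_transfer_eq {c : ℂ} {τ : CStarState Γ.CStar} (h : ∀ a, τ a = transfer c τ a)
    (e : Γ.Edge) (a : Γ.CStar) :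
    τ (Γ.S e * a) = c * τ (a * Γ.S e) ∧ τ (a * star (Γ.S e)) = c * τ (star (Γ.S e) * a) := by
  classical
  -- Vertex projections centralize `τ`: after one transfer, `p_v` on either side selects the same
  -- edges, those with source `v`.
  have hp : ∀ v a, τ (Γ.p v * a) = τ (a * Γ.p v) := fun v a => by
    rw [h, h (a * Γ.p v), transfer_apply, transfer_apply]
    congr 1
    refine Finset.sum_congr rfl fun f _ => ?_
    rw [← mul_assoc (star _), star_S_mul_p, mul_assoc (star _) (a * _), mul_assoc a, p_mul_S]
    split_ifs <;> simp [mul_assoc]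
  constructor
  · rw [h, transfer_apply]
    -- Only `f = e` survives, leaving `τ(p_{t(e)} a S_e)`; centrality moves the projection to the
    -- right, where `S_e` absorbs it.
    have : ∀ f, τ (star (Γ.S f) * (Γ.S e * a) * Γ.S f)
        = if f = e then τ (a * Γ.S e) else 0 := fun f => by
      rw [← mul_assoc (star _), star_S_mul_S]
      split_ifs with hf
      · subst hf
        rw [mul_assoc, hp, mul_assoc, S_mul_p_tgt]
      · simp
    simp [this]
  · rw [h, transfer_apply]
    have : ∀ f, τ (star (Γ.S f) * (a * star (Γ.S e)) * Γ.S f)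
        = if e = f then τ (star (Γ.S e) * a) else 0 := fun f => by
      rw [← mul_assoc, mul_assoc _ _ (Γ.S f), star_S_mul_S]
      split_ifs with hf
      · subst hf
        rw [← hp, ← mul_assoc, p_tgt_mul_star_S]
      · simp
    simp [this]

open scoped Classical in
theorem exists_isConformal [Nonempty V] (h : Γ.NoSinks) {lam : ℕ} (hlam : 0 < lam)
    (hrow : ∀ v, (Finset.univ.filter fun e : Γ.Edge => e.src = v).card = lam) :
    ∃ τ : CStarState Γ.CStar, IsConformal (lam : ℂ)⁻¹ τ.toCLM ∧
      ∀ v, τ (Γ.p v) = 1 / (Fintype.card V : ℂ) := by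
  have hm : (Fintype.card V : ℂ) ≠ 0 := by exact_mod_cast Fintype.card_ne_zero
  obtain ⟨τ₀, hτ₀⟩ := exists_state_apply_p h
  let T := {τ : CStarState Γ.CStar // ∀ v, τ (Γ.p v) = 1 / (Fintype.card V : ℂ)}
  -- The transfer is again a state because the vertex values `1/m` are preserved and sum to `1`.
  let next : T → T := fun τ => ⟨CStarState.ofLinear (transfer (lam : ℂ)⁻¹ τ.1) (by
      refine (congrArg _ Γ.sum_p.symm).trans ?_
      rw [map_sum, Finset.sum_congr rfl fun v _ => transfer_apply_p hlam hrow τ.2 v]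
      simp [hm]) (fun b => by
      rw [transfer_apply]
      refine mul_nonneg (by positivity) (Finset.sum_nonneg fun e _ => ?_)
      have : star (Γ.S e) * (star b * b) * Γ.S e = star (b * Γ.S e) * (b * Γ.S e) := by
        simp [mul_assoc]
      rw [this]
      exact τ.1.apply_star_mul_self_nonneg _), transfer_apply_p hlam hrow τ.2⟩
  let seq : ℕ → T := fun n => n.rec ⟨τ₀, hτ₀⟩ fun _ τ => next τ
  obtain ⟨ρ, hρc, hρs⟩ := CStarState.exists_banachLimit fun n => (seq n).1
  have hρp : ∀ v, ρ (Γ.p v) = 1 / (Fintype.card V : ℂ) := fun v => hρc _ _ fun n => (seq n).2 v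
  have hρt : ∀ a, ρ a = transfer (lam : ℂ)⁻¹ ρ a := fun a => by
    have := hρs a ((lam : ℂ)⁻¹ • ∑ e, star (Γ.S e) * a * Γ.S e) fun n => by
      change (lam : ℂ)⁻¹ * ∑ e, (seq n).1 (star (Γ.S e) * a * Γ.S e) = _
      rw [map_smul, map_sum, smul_eq_mul]
    rw [this, map_smul, map_sum, smul_eq_mul, transfer_apply]
  -- The fixed point `ρ` need not be gauge-invariant. A Banach limit over integer times is invariant
  -- at time one, hence at all times by `apply_dynamics_eq`; the relations survive because both
  -- sides of each acquire the same phase.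
  obtain ⟨κ, hκc, hκs⟩ := CStarState.exists_banachLimit fun n : ℕ => ρ.comp (Γ.dynamics n)
  have hdyn : ∀ (n : ℕ) (a : Γ.CStar),
      Γ.dynamics ((n + 1 : ℕ) : ℝ) a = Γ.dynamics n (Γ.dynamics 1 a) := fun n a => by
    rw [Nat.cast_succ, dynamics_add]
  have hone : ∀ a, κ.toCLM (Γ.dynamics 1 a) = κ.toCLM a := fun a =>
    (hκs a _ fun n => by rw [CStarState.comp_apply, CStarState.comp_apply, hdyn]).symm
  have hrel := S_mul_of_transfer_eq hρt
  refine ⟨κ, ⟨fun e a => ?_, fun e a => ?_, apply_dynamics_eq hone⟩, fun v => ?_⟩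
  · have := hκc (Γ.S e * a - (lam : ℂ)⁻¹ • (a * Γ.S e)) 0 fun n => by
      rw [CStarState.comp_apply, map_sub, map_smul, map_mul, map_mul, dynamics_S, smul_mul_assoc,
        mul_smul_comm, map_sub, map_smul, map_smul, map_smul, (hrel _ _).1]
      simp only [smul_eq_mul]
      ring
    rw [map_sub, map_smul, sub_eq_zero] at this
    exact this
  · have := hκc (a * star (Γ.S e) - (lam : ℂ)⁻¹ • (star (Γ.S e) * a)) 0 fun n => by
      rw [CStarState.comp_apply, map_sub, map_smul, map_mul, map_mul, map_star, dynamics_S,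
        star_smul, smul_mul_assoc, mul_smul_comm, map_sub, map_smul, map_smul, map_smul,
        (hrel _ _).2]
      simp only [smul_eq_mul]
      ring
    rw [map_sub, map_smul, sub_eq_zero] at this
    exact this
  · exact hκc _ _ fun n => by rw [CStarState.comp_apply, dynamics_p, hρp]

end Digraph

namespace Digraph

/-! ### The quantum automorphism group -/

section QuantumAutomorphisms

open scoped Classical

variable {V : Type u} (Γ : Digraph V)

theorem adj_edge (e : Γ.Edge) : Γ.Adj e.src e.tgt := e.2

theorem edge_ext {e f : Γ.Edge} (hs : e.src = f.src) (ht : e.tgt = f.tgt) : e = f :=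
  Subtype.ext (Prod.ext hs ht)

variable [Fintype V]

theorem sum_edge {M : Type*} [AddCommMonoid M] (F : V → V → M) :
    ∑ l : Γ.Edge, F l.src l.tgt = ∑ v, ∑ w, if Γ.Adj v w then F v w else 0 := by
  rw [← Finset.sum_product', Finset.univ_product_univ, ← Finset.sum_filter]
  refine Finset.sum_bij (fun l _ => l.1) (fun l _ => by simpa using l.2)
    (fun l _ l' _ h => Subtype.ext h) (fun x hx => ⟨⟨x, by simpa using hx⟩, Finset.mem_univ _, rfl⟩)
    (fun l _ => rfl)

theorem sum_edge_src {M : Type*} [AddCommMonoid M] (F : V → M) (v : V) :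
    ∑ e : Γ.Edge with e.src = v, F e.tgt = ∑ w, if Γ.Adj v w then F w else 0 := by
  rw [Finset.sum_filter, Γ.sum_edge fun x w => if x = v then F w else 0,
    Finset.sum_eq_single v]
  · simp
  · intro x _ hx
    simp [hx]
  · simp

theorem uu_mul_self (v w : V) : Γ.uu v w * Γ.uu v w = Γ.uu v w := by
  have h := UniversalCStar.mk_eq_zero Γ.QAutRel (QAutRel.idem v w)
  rw [map_sub, map_mul, sub_eq_zero] at h
  exact h

theorem star_uu (v w : V) : star (Γ.uu v w) = Γ.uu v w := by
  have h := UniversalCStar.mk_eq_zero Γ.QAutRel (QAutRel.selfAdjoint v w)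
  rw [map_sub, map_star, sub_eq_zero] at h
  exact h

theorem sum_uu_row (v : V) : ∑ w, Γ.uu v w = 1 := by
  have h := UniversalCStar.mk_eq_zero Γ.QAutRel (QAutRel.row v)
  rw [map_sub, map_sum, map_one, sub_eq_zero] at h
  exact h

theorem sum_uu_col (w : V) : ∑ v, Γ.uu v w = 1 := by
  have h := UniversalCStar.mk_eq_zero Γ.QAutRel (QAutRel.col w)
  rw [map_sub, map_sum, map_one, sub_eq_zero] at h
  exact h

theorem sum_uu_comm (v w : V) :
    ∑ x, (if Γ.Adj x w then Γ.uu v x else 0) = ∑ x, if Γ.Adj v x then Γ.uu x w else 0 := by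
  have h := UniversalCStar.mk_eq_zero Γ.QAutRel (QAutRel.comm v w)
  rw [map_sub, map_sum, map_sum, sub_eq_zero] at h
  simp only [map_smul] at h
  have h1 : ∀ a b (y : Γ.QAut), (Γ.vertexMatrix a b : ℂ) • y = if Γ.Adj a b then y else 0 := by
    intro a b y
    rw [vertexMatrix, Matrix.of_apply]
    split_ifs <;> simp
  simp only [h1] at h
  exact h

theorem uu_mul_uu_row (v w x : V) :
    Γ.uu v w * Γ.uu v x = if w = x then Γ.uu v w else 0 := by
  split_ifs with h
  · rw [h, uu_mul_self]
  · exact mul_eq_zero_of_sum_projections (q := fun w => Γ.uu v w) (Γ.star_uu v) (Γ.uu_mul_self v)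
      (Γ.sum_uu_row v) h

theorem uu_mul_uu_col (v w x : V) :
    Γ.uu w v * Γ.uu x v = if w = x then Γ.uu w v else 0 := by
  split_ifs with h
  · rw [h, uu_mul_self]
  · exact mul_eq_zero_of_sum_projections (q := fun w => Γ.uu w v) (fun w => Γ.star_uu w v)
      (fun w => Γ.uu_mul_self w v) (Γ.sum_uu_col v) h

/-- Multiply the entry `(v, y)` of `AD = DA` by `u_{vx}` on the left and `u_{wy}` on the right.
Orthogonality in row `v` leaves one term on one side, orthogonality in column `y` one term on the
other. Hence `u_{vx} u_{wy} = 0` unless the pairs are both edges or both non-edges. -/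
theorem uu_mul_uu_eq_ite {v w x y : V} :
    (if Γ.Adj x y then Γ.uu v x * Γ.uu w y else 0)
      = if Γ.Adj v w then Γ.uu v x * Γ.uu w y else 0 := by
  have hl : Γ.uu v x * (∑ z, if Γ.Adj z y then Γ.uu v z else 0)
      = if Γ.Adj x y then Γ.uu v x else 0 := by
    rw [Finset.mul_sum, Finset.sum_eq_single x]
    · rw [mul_ite, uu_mul_self, mul_zero]
    · intro z _ hz
      rw [mul_ite, uu_mul_uu_row, if_neg hz.symm, mul_zero, ite_self]
    · simp
  have hr : (∑ z, if Γ.Adj v z then Γ.uu z y else 0) * Γ.uu w y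
      = if Γ.Adj v w then Γ.uu w y else 0 := by
    rw [Finset.sum_mul, Finset.sum_eq_single w]
    · rw [ite_mul, uu_mul_self, zero_mul]
    · intro z _ hz
      rw [ite_mul, uu_mul_uu_col, if_neg hz, zero_mul, ite_self]
    · simp
  have hc := congrArg (fun a => a * Γ.uu w y) hl
  rw [sum_uu_comm, mul_assoc, hr, mul_ite, ite_mul, mul_zero, zero_mul] at hc
  exact hc.symm

theorem uu_mul_uu_eq_zero_of_adj {v w x y : V} (h : Γ.Adj x y) (h' : ¬ Γ.Adj v w) :
    Γ.uu v x * Γ.uu w y = 0 := by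
  have := Γ.uu_mul_uu_eq_ite (v := v) (w := w) (x := x) (y := y)
  rwa [if_pos h, if_neg h'] at this

theorem uu_mul_uu_eq_zero_of_not_adj {v w x y : V} (h : ¬ Γ.Adj x y) (h' : Γ.Adj v w) :
    Γ.uu v x * Γ.uu w y = 0 := by
  have := Γ.uu_mul_uu_eq_ite (v := v) (w := w) (x := x) (y := y)
  rw [if_neg h, if_pos h'] at this
  exact this.symm

/-- The matrix coefficients of the action on edges. -/
def edgeU (l e : Γ.Edge) : Γ.QAut := Γ.uu l.src e.src * Γ.uu l.tgt e.tgt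

theorem star_edgeU (l e : Γ.Edge) :
    star (Γ.edgeU l e) = Γ.uu l.tgt e.tgt * Γ.uu l.src e.src := by
  rw [edgeU, star_mul, star_uu, star_uu]

/-- The terms vanish when `(v, w)` is not an edge, so the sum extends to all pairs of vertices and
the column sums evaluate it. -/
theorem sum_edgeU_mul_star (e f : Γ.Edge) :
    ∑ l, Γ.edgeU l e * star (Γ.edgeU l f) = if e = f then 1 else 0 := by
  simp only [star_edgeU]
  simp only [edgeU]
  rw [Γ.sum_edge fun v w =>
    Γ.uu v e.src * Γ.uu w e.tgt * (Γ.uu w f.tgt * Γ.uu v f.src)]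
  have h : ∀ v w, (if Γ.Adj v w then
      Γ.uu v e.src * Γ.uu w e.tgt * (Γ.uu w f.tgt * Γ.uu v f.src) else 0)
      = if e.tgt = f.tgt then Γ.uu v e.src * Γ.uu w e.tgt * Γ.uu v f.src else 0 := by
    intro v w
    have h1 : Γ.uu v e.src * Γ.uu w e.tgt * (Γ.uu w f.tgt * Γ.uu v f.src)
        = if e.tgt = f.tgt then Γ.uu v e.src * Γ.uu w e.tgt * Γ.uu v f.src else 0 := by
      rw [mul_assoc, ← mul_assoc (Γ.uu w _), uu_mul_uu_row]
      split_ifs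
      · rw [mul_assoc]
      · rw [zero_mul, mul_zero]
    rw [h1]
    by_cases hvw : Γ.Adj v w
    · rw [if_pos hvw]
    · rw [if_neg hvw, Γ.uu_mul_uu_eq_zero_of_adj (Γ.adj_edge e) hvw, zero_mul, ite_self]
  simp only [h]
  by_cases ht : e.tgt = f.tgt
  · simp only [if_pos ht, ← Finset.sum_mul, ← Finset.mul_sum, sum_uu_col, mul_one, uu_mul_uu_row]
    by_cases hs : e.src = f.src
    · simp only [if_pos hs]
      rw [sum_uu_col, if_pos (Γ.edge_ext hs ht)]
    · simp only [if_neg hs, Finset.sum_const_zero]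
      rw [if_neg fun h => hs (by rw [h])]
  · simp only [if_neg ht, Finset.sum_const_zero]
    rw [if_neg fun h => ht (by rw [h])]

/-- Dually, the sum extends from the successors of `v` to all vertices, and the row sum applies. -/
theorem sum_edgeU_mul_star_src (l l' : Γ.Edge) (v : V) :
    ∑ e : Γ.Edge with e.src = v, Γ.edgeU l e * star (Γ.edgeU l' e)
      = if l = l' then Γ.uu l.src v else 0 := by
  have h : ∀ e ∈ Finset.univ.filter (fun e : Γ.Edge => e.src = v),
      Γ.edgeU l e * star (Γ.edgeU l' e)
        = Γ.uu l.src v * (Γ.uu l.tgt e.tgt * Γ.uu l'.tgt e.tgt) * Γ.uu l'.src v := fun e he => by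
    rw [star_edgeU, edgeU, (Finset.mem_filter.1 he).2]
    simp only [mul_assoc]
  rw [Finset.sum_congr rfl h, Γ.sum_edge_src
    (fun y => Γ.uu l.src v * (Γ.uu l.tgt y * Γ.uu l'.tgt y) * Γ.uu l'.src v)]
  simp only [uu_mul_uu_col]
  by_cases ht : l.tgt = l'.tgt
  · have h2 : ∀ y, (if Γ.Adj v y then
        Γ.uu l.src v * (if l.tgt = l'.tgt then Γ.uu l.tgt y else 0) * Γ.uu l'.src v else 0)
        = Γ.uu l.src v * Γ.uu l.tgt y * Γ.uu l'.src v := fun y => by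
      rw [if_pos ht]
      by_cases hy : Γ.Adj v y
      · rw [if_pos hy]
      · rw [if_neg hy, Γ.uu_mul_uu_eq_zero_of_not_adj hy (Γ.adj_edge l), zero_mul]
    simp only [h2]
    rw [← Finset.sum_mul, ← Finset.mul_sum, sum_uu_row, mul_one, uu_mul_uu_col]
    by_cases hs : l.src = l'.src
    · rw [if_pos hs, if_pos (Γ.edge_ext hs ht)]
    · rw [if_neg hs, if_neg fun h => hs (by rw [h])]
  · simp only [if_neg ht, mul_zero, zero_mul, ite_self, Finset.sum_const_zero]
    rw [if_neg fun h => ht (by rw [h])]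

/-- The image of `p_v` under the action of the quantum automorphism group. -/
def coactP (v : V) : MinTensor Γ.CStar Γ.QAut := ∑ k, minTmul (Γ.p k) (Γ.uu k v)

/-- The image of `S_e` under the action of the quantum automorphism group. -/
def coactS (e : Γ.Edge) : MinTensor Γ.CStar Γ.QAut := ∑ l, minTmul (Γ.S l) (Γ.edgeU l e)

theorem star_coactS (e : Γ.Edge) :
    star (Γ.coactS e) = ∑ l, minTmul (star (Γ.S l)) (star (Γ.edgeU l e)) := by
  rw [coactS, star_sum]
  simp only [star_minTmul]

theorem coactP_mul_coactP (v w : V) :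
    Γ.coactP v * Γ.coactP w = if v = w then Γ.coactP v else 0 := by
  have h : ∀ k l, minTmul (Γ.p k) (Γ.uu k v) * minTmul (Γ.p l) (Γ.uu l w)
      = if k = l then (if v = w then minTmul (Γ.p k) (Γ.uu k v) else 0) else 0 := fun k l => by
    rw [minTmul_mul, p_mul_p]
    by_cases hkl : k = l
    · subst hkl
      rw [if_pos rfl, if_pos rfl, uu_mul_uu_row]
      split_ifs
      · rfl
      · exact minTmul_zero _
    · rw [if_neg hkl, if_neg hkl, zero_minTmul]
  rw [coactP, coactP, Finset.sum_mul_sum]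
  simp only [h, Finset.sum_ite_eq, Finset.mem_univ, if_true]
  split_ifs
  · rfl
  · exact Finset.sum_const_zero

/-- The Cuntz-Krieger family defining the action of the quantum automorphism group. -/
def coactFamily : Γ.CKFamily (MinTensor Γ.CStar Γ.QAut) where
  p := Γ.coactP
  S := Γ.coactS
  idem v := by rw [coactP_mul_coactP, if_pos rfl]
  selfAdjoint v := by
    rw [coactP, star_sum]
    simp only [star_minTmul, star_p, star_uu]
  orthogonal v w h := by rw [coactP_mul_coactP, if_neg h]
  unit := by
    simp only [coactP]
    rw [Finset.sum_comm]
    simp only [← minTmul_sum, sum_uu_row, ← sum_minTmul, sum_p, minTmul_one_one]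
  initial e := by
    rw [star_coactS, coactS, Finset.sum_mul_sum]
    have h : ∀ l l', minTmul (star (Γ.S l)) (star (Γ.edgeU l e)) * minTmul (Γ.S l') (Γ.edgeU l' e)
        = if l = l' then minTmul (Γ.p l.tgt) (star (Γ.edgeU l e) * Γ.edgeU l e) else 0 := by
      intro l l'
      rw [minTmul_mul, star_S_mul_S]
      split_ifs with hl
      · rw [hl]
      · exact zero_minTmul _
    simp only [h, Finset.sum_ite_eq, Finset.mem_univ, if_true]
    simp only [star_edgeU]
    simp only [edgeU]
    rw [Γ.sum_edge fun v w => minTmul (Γ.p w)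
      (Γ.uu w e.tgt * Γ.uu v e.src * (Γ.uu v e.src * Γ.uu w e.tgt))]
    -- Non-edges contribute zero, so `v` may range over all vertices and `∑_v u_{v s(e)} = 1`
    -- removes the middle factor.
    have h2 : ∀ v w, (if Γ.Adj v w then minTmul (Γ.p w)
        (Γ.uu w e.tgt * Γ.uu v e.src * (Γ.uu v e.src * Γ.uu w e.tgt)) else 0)
        = minTmul (Γ.p w) (Γ.uu w e.tgt * Γ.uu v e.src * Γ.uu w e.tgt) := fun v w => by
      rw [mul_assoc (Γ.uu w _), ← mul_assoc (Γ.uu v _), uu_mul_self]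
      by_cases hvw : Γ.Adj v w
      · rw [if_pos hvw, mul_assoc]
      · rw [if_neg hvw, mul_assoc, Γ.uu_mul_uu_eq_zero_of_adj (Γ.adj_edge e) hvw, mul_zero,
          minTmul_zero]
    simp only [h2]
    rw [Finset.sum_comm]
    simp only [← minTmul_sum, ← Finset.sum_mul, ← Finset.mul_sum, sum_uu_col, mul_one, uu_mul_self]
    rfl
  range v := by
    have h : ∀ e, Γ.coactS e * star (Γ.coactS e)
        = ∑ l, ∑ l', minTmul (Γ.S l * star (Γ.S l')) (Γ.edgeU l e * star (Γ.edgeU l' e)) := by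
      intro e
      rw [star_coactS, coactS, Finset.sum_mul_sum]
      simp only [minTmul_mul]
    simp only [h]
    rw [Finset.sum_comm]
    have h2 : ∀ l, (∑ e : Γ.Edge with e.src = v, ∑ l', minTmul (Γ.S l * star (Γ.S l'))
        (Γ.edgeU l e * star (Γ.edgeU l' e)))
        = minTmul (Γ.S l * star (Γ.S l)) (Γ.uu l.src v) := fun l => by
      rw [Finset.sum_comm]
      simp only [← minTmul_sum, sum_edgeU_mul_star_src]
      rw [Finset.sum_eq_single l]
      · rw [if_pos rfl]
      · intro l' _ hl
        rw [if_neg hl.symm, minTmul_zero]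
      · simp
    simp only [h2]
    rw [← Finset.sum_fiberwise Finset.univ Edge.src, coactP]
    refine Finset.sum_congr rfl fun k _ => ?_
    rw [← sum_S_mul_star_src, sum_minTmul]
    refine Finset.sum_congr rfl fun l hl => ?_
    rw [(Finset.mem_filter.1 hl).2]

/-- The action of the quantum automorphism group on the graph algebra. -/
def coaction : Γ.CStar →⋆ₐ[ℂ] MinTensor Γ.CStar Γ.QAut := Γ.coactFamily.lift

theorem coaction_p (v : V) : Γ.coaction (Γ.p v) = Γ.coactP v := CKFamily.lift_p _ v

theorem coaction_S (e : Γ.Edge) : Γ.coaction (Γ.S e) = Γ.coactS e := CKFamily.lift_S _ e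

theorem isQAutAction_coaction : Γ.IsQAutAction Γ.coaction := ⟨Γ.coaction_p, Γ.coaction_S⟩

/-- The span of the tensors with homogeneous left factor. -/
def homogeneousTensors (n : ℤ) : Submodule ℂ (MinTensor Γ.CStar Γ.QAut) :=
  Submodule.span ℂ {x | ∃ a b, IsHomogeneous n a ∧ x = minTmul a b}

variable {Γ}

theorem minTmul_mem {n : ℤ} {a : Γ.CStar} (ha : IsHomogeneous n a) (b : Γ.QAut) :
    minTmul a b ∈ Γ.homogeneousTensors n := Submodule.subset_span ⟨a, b, ha, rfl⟩

theorem mul_mem_homogeneousTensors {m n : ℤ} {x y : MinTensor Γ.CStar Γ.QAut}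
    (hx : x ∈ Γ.homogeneousTensors m) (hy : y ∈ Γ.homogeneousTensors n) :
    x * y ∈ Γ.homogeneousTensors (m + n) := by
  induction hx, hy using Submodule.span_induction₂ with
  | mem_mem x y hx hy =>
    obtain ⟨a, b, ha, rfl⟩ := hx
    obtain ⟨a', b', ha', rfl⟩ := hy
    rw [minTmul_mul]
    exact minTmul_mem (ha.mul ha') _
  | zero_left y _ => rw [zero_mul]; exact zero_mem _
  | zero_right x _ => rw [mul_zero]; exact zero_mem _
  | add_left x y z _ _ _ h1 h2 => rw [add_mul]; exact add_mem h1 h2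
  | add_right x y z _ _ _ h1 h2 => rw [mul_add]; exact add_mem h1 h2
  | smul_left r x y _ _ h => rw [smul_mul_assoc]; exact Submodule.smul_mem _ r h
  | smul_right r x y _ _ h => rw [mul_smul_comm]; exact Submodule.smul_mem _ r h

theorem coaction_pathS_mem (μ : List Γ.Edge) :
    Γ.coaction (Γ.pathS μ) ∈ Γ.homogeneousTensors μ.length := by
  induction μ with
  | nil =>
    rw [pathS_nil, map_one, ← minTmul_one_one]
    exact minTmul_mem IsHomogeneous.one _
  | cons e μ ih =>
    rw [pathS_cons, map_mul, coaction_S, List.length_cons, Nat.cast_succ, add_comm]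
    exact mul_mem_homogeneousTensors
      (sum_mem fun l _ => minTmul_mem (IsHomogeneous.S l) _) ih

theorem coaction_star_pathS_mem (μ : List Γ.Edge) :
    Γ.coaction (star (Γ.pathS μ)) ∈ Γ.homogeneousTensors (-μ.length) := by
  induction μ with
  | nil =>
    rw [pathS_nil, star_one, map_one, ← minTmul_one_one]
    exact minTmul_mem IsHomogeneous.one _
  | cons e μ ih =>
    rw [pathS_cons, star_mul, map_mul, map_star _ (Γ.S e), coaction_S, List.length_cons,
      Nat.cast_succ, neg_add, star_coactS]
    exact mul_mem_homogeneousTensors ih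
      (sum_mem fun l _ => minTmul_mem (IsHomogeneous.S l).star _)

/-! ### Invariance of conformal states under the quantum automorphism group -/

variable {c : ℂ} {τ : CStarState Γ.CStar}

theorem IsConformal.minSlice_eq_zero (hτ : IsConformal c τ.toCLM) {n : ℤ} (hn : n ≠ 0)
    {x : MinTensor Γ.CStar Γ.QAut} (hx : x ∈ Γ.homogeneousTensors n) : minSlice τ x = 0 := by
  induction hx using Submodule.span_induction with
  | mem x hx =>
    obtain ⟨a, b, ha, rfl⟩ := hx
    have : τ a = 0 := ha.apply_eq_zero hn (hτ.invariant 1 a)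
    rw [minSlice_minTmul, this, zero_smul]
  | zero => exact map_zero _
  | add x y _ _ hx hy => rw [map_add, hx, hy, add_zero]
  | smul r x _ hx => rw [map_smul, hx, smul_zero]

theorem IsConformal.S_mul_mul_star (hτ : IsConformal c τ.toCLM) (l l' : Γ.Edge) (a : Γ.CStar) :
    τ (Γ.S l * a * star (Γ.S l')) = if l' = l then c * τ (a * Γ.p l.tgt) else 0 := by
  have h := hτ.S_mul l (a * star (Γ.S l'))
  rw [← mul_assoc, mul_assoc a, star_S_mul_S] at h
  refine h.trans ?_
  split_ifs with hl
  · rw [hl]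
    rfl
  · rw [mul_zero, map_zero, mul_zero]

theorem IsConformal.minSlice_conj (hτ : IsConformal c τ.toCLM) (l l' : Γ.Edge) (b b' : Γ.QAut)
    (x : MinTensor Γ.CStar Γ.QAut) :
    minSlice τ (minTmul (Γ.S l) b * x * minTmul (star (Γ.S l')) b')
      = if l' = l then c • (b * minSlice τ (x * minTmul (Γ.p l.tgt) 1) * b') else 0 := by
  split_ifs with hl
  · refine minSlice_mul_mul (fun a => ?_) b b' x
    rw [hτ.S_mul_mul_star, if_pos hl]
  · refine (minSlice_mul_mul (c := 0) (a₃ := 0) (fun a => ?_) b b' x).trans (zero_smul _ _)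
    rw [hτ.S_mul_mul_star, if_neg hl, zero_mul]

/-- In the presence of `1 ⊗ u_{wy}`, the projection `p_w ⊗ 1` may be traded for the image of `p_y`
under the action, by orthogonality in column `y`. -/
theorem coactP_mul_minTmul (w y : V) :
    Γ.coactP y * minTmul 1 (Γ.uu w y) = minTmul (Γ.p w) 1 * minTmul 1 (Γ.uu w y) := by
  rw [coactP, Finset.sum_mul, Finset.sum_eq_single w]
  · rw [minTmul_mul, minTmul_mul, uu_mul_self, one_mul]
  · intro k _ hk
    rw [minTmul_mul, uu_mul_uu_col, if_neg hk, minTmul_zero]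
  · simp

/-- Write `U` for `edgeU`. Conformality reduces the double sum over `l`, `l'` to `c ∑_l U_{le} ·
slice(α(x)(p_{t(l)} ⊗ 1)) · U_{lf}*`. As `U_{lf}*` starts with `u_{t(l)t(f)}`, the trade above
replaces `p_{t(l)} ⊗ 1` by `α(p_{t(f)})`, and the hypothesis makes the slice the scalar `τ(x
p_{t(f)})`. What remains is `∑_l U_{le} U_{lf}*`, which is `1` or `0`. -/
theorem IsConformal.minSlice_coaction_conj (hτ : IsConformal c τ.toCLM) (x : Γ.CStar)
    (hx : ∀ y, minSlice τ (Γ.coaction (x * Γ.p y)) = τ (x * Γ.p y) • 1) (e f : Γ.Edge) :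
    minSlice τ (Γ.coaction (Γ.S e * x * star (Γ.S f))) = τ (Γ.S e * x * star (Γ.S f)) • 1 := by
  have h2 : ∀ l : Γ.Edge, minSlice τ (Γ.coaction x * minTmul (Γ.p l.tgt) 1) * star (Γ.edgeU l f)
      = τ (x * Γ.p f.tgt) • star (Γ.edgeU l f) := fun l => by
    rw [star_edgeU, ← mul_assoc, ← minSlice_mul_minTmul_one, mul_assoc (Γ.coaction x),
      ← coactP_mul_minTmul, ← mul_assoc (Γ.coaction x), ← coaction_p, ← map_mul,
      minSlice_mul_minTmul_one, hx, smul_one_mul, smul_mul_assoc]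
  rw [map_mul Γ.coaction, map_mul Γ.coaction, map_star, coaction_S, coaction_S, star_coactS,
    coactS, Finset.sum_mul,
    Finset.sum_mul_sum]
  simp only [map_sum, hτ.minSlice_conj, Finset.sum_ite_eq', Finset.mem_univ, if_true]
  simp only [mul_assoc (Γ.edgeU _ _), h2, mul_smul_comm]
  rw [← Finset.smul_sum, ← Finset.smul_sum, sum_edgeU_mul_star, hτ.S_mul_mul_star]
  by_cases h : e = f
  · rw [if_pos h, if_pos h.symm, smul_smul, h]
  · rw [if_neg h, if_neg (Ne.symm h), smul_zero, smul_zero, zero_smul]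

/-- The trailing `p_y` is the strengthening that the induction on path length requires. For unequal
lengths both sides vanish, since the action preserves the gauge degree. -/
theorem IsConformal.minSlice_coaction_monomial_mul_p (hτ : IsConformal c τ.toCLM) {k : ℂ}
    (hp : ∀ v, τ (Γ.p v) = k) (μ ν : List Γ.Edge) (y : V) :
    minSlice τ (Γ.coaction (Γ.pathS μ * star (Γ.pathS ν) * Γ.p y))
      = τ (Γ.pathS μ * star (Γ.pathS ν) * Γ.p y) • 1 := by
  by_cases hlen : μ.length = ν.length
  · induction μ generalizing ν y with
    | nil =>
      obtain rfl := List.length_eq_zero_iff.1 hlen.symm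
      rw [pathS_nil, star_one, mul_one, one_mul, coaction_p, coactP, map_sum]
      simp only [minSlice_minTmul, hp]
      rw [← Finset.smul_sum, sum_uu_col]
    | cons e μ ih =>
      obtain _ | ⟨f, ν⟩ := ν
      · simp at hlen
      have : Γ.pathS (e :: μ) * star (Γ.pathS (f :: ν)) * Γ.p y
          = Γ.S e * (Γ.pathS μ * star (Γ.pathS ν)) * (star (Γ.S f) * Γ.p y) := by
        simp [pathS_cons, mul_assoc]
      rw [this, star_S_mul_p]
      split_ifs
      · exact hτ.minSlice_coaction_conj _ (fun y => ih ν y (by simpa using hlen)) e f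
      · simp
  · have hn : (μ.length : ℤ) + -ν.length + 0 ≠ 0 := by omega
    have h1 : τ (Γ.pathS μ * star (Γ.pathS ν) * Γ.p y) = 0 :=
      (((IsHomogeneous.pathS μ).mul (IsHomogeneous.pathS ν).star).mul
        (IsHomogeneous.p y)).apply_eq_zero hn (hτ.invariant 1 _)
    rw [h1, zero_smul, map_mul Γ.coaction, map_mul Γ.coaction, coaction_p]
    exact hτ.minSlice_eq_zero hn (mul_mem_homogeneousTensors (mul_mem_homogeneousTensors
      (coaction_pathS_mem μ) (coaction_star_pathS_mem ν))
      (sum_mem fun k _ => minTmul_mem (IsHomogeneous.p k) _))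

theorem IsConformal.isQAutInvariant (hτ : IsConformal c τ.toCLM) {k : ℂ}
    (hp : ∀ v, τ (Γ.p v) = k) : Γ.IsQAutInvariant τ := by
  refine ⟨Γ.coaction, Γ.isQAutAction_coaction, minSlice τ, minSlice_minTmul τ, fun a => ?_⟩
  have : (minSlice τ).comp (starHomCLM Γ.coaction) = τ.toCLM.smulRight (1 : Γ.QAut) := by
    refine Γ.ext_monomial fun μ ν => ?_
    change minSlice τ (Γ.coaction _) = τ _ • (1 : Γ.QAut)
    have hsum : Γ.pathS μ * star (Γ.pathS ν)
        = ∑ y, Γ.pathS μ * star (Γ.pathS ν) * Γ.p y := by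
      rw [← Finset.mul_sum, sum_p, mul_one]
    rw [hsum, map_sum, map_sum, map_sum, Finset.sum_smul]
    exact Finset.sum_congr rfl fun y _ => hτ.minSlice_coaction_monomial_mul_p hp μ ν y
  exact congrArg (fun f : Γ.CStar →L[ℂ] Γ.QAut => f a) this

end QuantumAutomorphisms

end Digraph

/-! ### Circulant graphs -/

theorem eq_of_invariant_of_isCycleOn {V : Type*} [Finite V] {X : Type*} {f : Equiv.Perm V}
    (hf : f.IsCycleOn Set.univ) {F : V → X} (hF : ∀ v, F (f v) = F v) (v w : V) : F w = F v := by
  obtain ⟨n, rfl⟩ := (hf.2 (Set.mem_univ v) (Set.mem_univ w)).exists_nat_pow_eq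
  induction n with
  | zero => rfl
  | succ n ih => rw [pow_succ', Equiv.Perm.mul_apply, hF, ih]

/-! ### Spectral radius of a matrix with constant row sums -/

section SpectralRadius

attribute [local instance] Matrix.linftyOpNormedRing Matrix.linftyOpNormedAlgebra

/-- The spectral radius of a nonnegative matrix with constant row sums. -/
theorem spectralRadius_map_natCast {V : Type*} [Fintype V] [DecidableEq V] [Nonempty V]
    {D : Matrix V V ℕ} {lam : ℕ} (h : ∀ v, ∑ w, D v w = lam) :
    spectralRadius ℂ (D.map (Nat.cast : ℕ → ℂ)) = lam := by
  -- The constant vector is an eigenvector.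
  have hmem : (lam : ℂ) ∈ spectrum ℂ (D.map (Nat.cast : ℕ → ℂ)) := by
    rw [← Matrix.spectrum_toLin']
    refine Module.End.HasEigenvalue.mem_spectrum
      (Module.End.hasEigenvalue_of_hasEigenvector (x := fun _ => 1) ⟨?_, ?_⟩)
    · rw [Module.End.mem_eigenspace_iff, Matrix.toLin'_apply]
      ext v
      simp only [Matrix.mulVec, dotProduct, Matrix.map_apply, mul_one, Pi.smul_apply, smul_eq_mul]
      exact_mod_cast h v
    · intro h0
      obtain ⟨v⟩ := ‹Nonempty V›
      exact one_ne_zero (congrFun h0 v)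
  refine le_antisymm ?_ ?_
  · refine (spectrum.spectralRadius_le_nnnorm _).trans ?_
    -- The norm is the operator norm on `ℓ^∞`, that is, the largest absolute row sum.
    have : ‖D.map (Nat.cast : ℕ → ℂ)‖₊ ≤ (lam : NNReal) := by
      rw [Matrix.linfty_opNNNorm_def]
      refine Finset.sup_le fun v _ => ?_
      simp only [Matrix.map_apply]
      have hn : ∀ k : ℕ, ‖(k : ℂ)‖₊ = k := fun k => by
        ext; simp
      simp only [hn]
      exact_mod_cast (h v).le
    exact_mod_cast this
  · have := le_iSup₂ (f := fun (k : ℂ) (_ : k ∈ spectrum ℂ (D.map (Nat.cast : ℕ → ℂ))) =>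
      (‖k‖₊ : ENNReal)) (lam : ℂ) hmem
    refine le_trans (le_of_eq ?_) this
    have hn : ‖(lam : ℂ)‖₊ = lam := by ext; simp
    rw [hn]
    rfl

end SpectralRadius

namespace Digraph

/-! ### Automorphisms and vertex values of conformal states -/

section Circulant

variable {V : Type u} [Fintype V] {Γ : Digraph V}

open scoped Classical in
theorem sum_vertexMatrix (v : V) :
    ∑ w, Γ.vertexMatrix v w = (Finset.univ.filter fun e : Γ.Edge => e.src = v).card := by
  rw [Finset.card_eq_sum_ones, Γ.sum_edge_src (fun _ => 1) v]
  rfl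

theorem sum_vertexMatrix_apply (g : Γ.Adj ≃r Γ.Adj) (v : V) :
    ∑ w, Γ.vertexMatrix (g v) w = ∑ w, Γ.vertexMatrix v w := by
  classical
  rw [← Equiv.sum_comp g.toEquiv]
  refine Finset.sum_congr rfl fun w _ => ?_
  simp only [vertexMatrix, Matrix.of_apply]
  exact if_congr g.map_rel_iff rfl rfl

theorem autAction_p (g : Γ.Adj ≃r Γ.Adj) (v : V) : Γ.autAction g (Γ.p v) = Γ.p (g v) :=
  CKFamily.lift_p _ v

theorem autAction_S (g : Γ.Adj ≃r Γ.Adj) (e : Γ.Edge) :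
    Γ.autAction g (Γ.S e) = Γ.S (edgePerm g e) :=
  CKFamily.lift_S _ e

theorem autAction_pathS (g : Γ.Adj ≃r Γ.Adj) (μ : List Γ.Edge) :
    Γ.autAction g (Γ.pathS μ) = Γ.pathS (μ.map (edgePerm g)) := by
  induction μ with
  | nil => exact map_one _
  | cons e μ ih => rw [List.map_cons, pathS_cons, pathS_cons, map_mul, autAction_S, ih]

theorem autAction_dynamics (g : Γ.Adj ≃r Γ.Adj) (t : ℝ) (a : Γ.CStar) :
    Γ.autAction g (Γ.dynamics t a) = Γ.dynamics t (Γ.autAction g a) := by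
  have : (starHomCLM (Γ.autAction g)).comp (starHomCLM (Γ.dynamics t))
      = (starHomCLM (Γ.dynamics t)).comp (starHomCLM (Γ.autAction g)) := by
    refine Γ.ext_monomial fun μ ν => ?_
    change Γ.autAction g (Γ.dynamics t _) = Γ.dynamics t (Γ.autAction g _)
    rw [IsHomogeneous.monomial μ ν t, map_smul, map_mul (Γ.autAction g), map_star, autAction_pathS,
      autAction_pathS, IsHomogeneous.monomial _ _ t, List.length_map, List.length_map]
  exact congrArg (fun f : Γ.CStar →L[ℂ] Γ.CStar => f a) this

/-- Composing `τ` with an automorphism gives a conformal functional with the same constant and the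
same vertex values, so uniqueness applies. -/
theorem IsConformal.isAutInvariant {c k : ℂ} {τ : CStarState Γ.CStar}
    (hτ : IsConformal c τ.toCLM) (hp : ∀ v, τ (Γ.p v) = k) : Γ.IsAutInvariant τ := by
  intro g a
  have h : IsConformal c (τ.comp (Γ.autAction g)).toCLM :=
    ⟨fun e a => by
      change τ (Γ.autAction g _) = c * τ (Γ.autAction g _)
      rw [map_mul (Γ.autAction g), map_mul (Γ.autAction g), autAction_S]
      exact hτ.S_mul _ _,
    fun e a => by
      change τ (Γ.autAction g _) = c * τ (Γ.autAction g _)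
      rw [map_mul (Γ.autAction g), map_mul (Γ.autAction g), map_star, autAction_S]
      exact hτ.mul_star_S _ _,
    fun t a => by
      change τ (Γ.autAction g _) = τ (Γ.autAction g _)
      rw [autAction_dynamics]
      exact hτ.invariant _ _⟩
  have h2 := h.ext hτ fun v => by
    change τ (Γ.autAction g _) = τ _
    rw [autAction_p, hp, hp]
  exact congrArg (fun f : Γ.CStar →L[ℂ] ℂ => f a) h2

/-- Apply `φ` to `p_v = ∑ S_e S_e*` and move each `S_e` to the right. For `c = e^{-β}` the vertex
values thus solve `D x = e^β x`. -/
theorem IsConformal.sum_apply_p {c : ℂ} {φ : Γ.CStar →L[ℂ] ℂ} (hφ : IsConformal c φ) (v : V) :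
    φ (Γ.p v) = c * ∑ w, (Γ.vertexMatrix v w : ℂ) * φ (Γ.p w) := by
  classical
  have h : ∀ e : Γ.Edge, φ (Γ.S e * star (Γ.S e)) = c * φ (Γ.p e.tgt) := fun e => by
    rw [hφ.S_mul, star_S_mul_S, if_pos rfl]
  rw [← sum_S_mul_star_src, map_sum]
  simp only [h]
  rw [Γ.sum_edge_src (fun w => c * φ (Γ.p w)), Finset.mul_sum]
  refine Finset.sum_congr rfl fun w _ => ?_
  rw [vertexMatrix, Matrix.of_apply]
  split_ifs <;> simp

theorem IsKMS.eq_log [Nonempty V] {lam : ℕ}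
    (hrow : ∀ v, ∑ w, Γ.vertexMatrix v w = lam) {β : ℝ} {τ : CStarState Γ.CStar}
    (hτ : Γ.IsKMS β τ) (hp : ∀ v, τ (Γ.p v) = 1 / (Fintype.card V : ℂ)) : β = Real.log lam := by
  obtain ⟨v⟩ := ‹Nonempty V›
  have hm : (Fintype.card V : ℂ) ≠ 0 := by exact_mod_cast Fintype.card_ne_zero (α := V)
  have h := hτ.isConformal.sum_apply_p v
  simp only [CStarState.toCLM_apply, hp] at h
  rw [← Finset.sum_mul, ← Nat.cast_sum, hrow, ← mul_assoc] at h
  have h1 : Complex.exp (-β) * lam = 1 :=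
    (mul_eq_right₀ (one_div_ne_zero hm)).1 h.symm
  have h2 : Real.exp (-β) * lam = 1 := by exact_mod_cast h1
  have h3 : (lam : ℝ) = Real.exp β := by
    rw [Real.exp_neg, inv_mul_eq_one₀ (Real.exp_ne_zero β)] at h2
    exact h2.symm
  rw [h3, Real.log_exp]

end Circulant

end Digraph

end

/-! ### The main theorem -/

theorem mainTheorem3 {V : Type*} [Fintype V] [Nonempty V] (Γ : Digraph V)
    (hcirc : Γ.IsCirculant) (hsink : Γ.NoSinks) :
    ∃ lam : ℕ, 0 < lam ∧ (∀ v, ∑ w, Γ.vertexMatrix v w = lam) ∧ Γ.vertexSpectralRadius = lam ∧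
      ∃ τ : CStarState Γ.CStar,
        Γ.IsKMS (Real.log lam) τ ∧ Γ.IsAutInvariant τ ∧
        (∀ v, τ (Γ.p v) = 1 / (Fintype.card V : ℂ)) ∧
        Γ.IsQAutInvariant τ ∧
        (∀ (β : ℝ) (τ' : CStarState Γ.CStar), Γ.IsKMS β τ' → Γ.IsAutInvariant τ' →
          τ' = τ ∧ β = Real.log lam) ∧
        (∀ (β : ℝ) (τ' : CStarState Γ.CStar), Γ.IsKMS β τ' →
          (∀ v, τ' (Γ.p v) = 1 / (Fintype.card V : ℂ)) → τ' = τ) := by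
  classical
  obtain ⟨g, hg⟩ := hcirc
  obtain ⟨v₀⟩ := ‹Nonempty V›
  have hm : (Fintype.card V : ℂ) ≠ 0 := by exact_mod_cast Fintype.card_ne_zero (α := V)
  obtain ⟨lam, hlam⟩ : ∃ lam, lam = ∑ w, Γ.vertexMatrix v₀ w := ⟨_, rfl⟩
  have hrow : ∀ v, ∑ w, Γ.vertexMatrix v w = lam := fun v => by
    rw [hlam]
    exact eq_of_invariant_of_isCycleOn hg (F := fun v => ∑ w, Γ.vertexMatrix v w)
      (Digraph.sum_vertexMatrix_apply g) v₀ v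
  have hcard : ∀ v, (Finset.univ.filter fun e : Γ.Edge => e.src = v).card = lam := fun v => by
    rw [← Digraph.sum_vertexMatrix, hrow]
  have hpos : 0 < lam := by
    obtain ⟨e, he⟩ := hsink v₀
    rw [← hcard v₀]
    exact Finset.card_pos.2 ⟨e, by simpa using he⟩
  have hexp : Complex.exp (-(Real.log lam : ℝ)) = (lam : ℂ)⁻¹ := by
    have hl : (0 : ℝ) < lam := by exact_mod_cast hpos
    rw [Complex.exp_neg, ← Complex.ofReal_exp, Real.exp_log hl, Complex.ofReal_natCast]
  obtain ⟨τ, hτ, hp⟩ := Digraph.exists_isConformal hsink hpos hcard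
  -- The vertex values fix `β`, hence the conformal constant; two conformal states with the same
  -- constant and vertex values coincide.
  have huniq : ∀ (β : ℝ) (τ' : CStarState Γ.CStar), Γ.IsKMS β τ' →
      (∀ v, τ' (Γ.p v) = 1 / (Fintype.card V : ℂ)) → τ' = τ := fun β τ' h hp' => by
    have hc := h.isConformal
    rw [h.eq_log hrow hp', hexp] at hc
    have := hc.ext hτ fun v => (hp' v).trans (hp v).symm
    exact CStarState.ext fun a => congrArg (fun f : Γ.CStar →L[ℂ] ℂ => f a) this
  refine ⟨lam, hpos, hrow, spectralRadius_map_natCast hrow, τ,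
    Digraph.isKMS_of_isConformal (by rwa [hexp]), hτ.isAutInvariant hp, hp, hτ.isQAutInvariant hp,
    fun β τ' h hinv => ?_, huniq⟩
  -- Invariance under the single automorphism `g` suffices: it is transitive on the vertices, so the
  -- `m` values are equal, and they sum to `1`.
  have hp' : ∀ v, τ' (Γ.p v) = 1 / (Fintype.card V : ℂ) := fun v => by
    have hconst : ∀ w, τ' (Γ.p w) = τ' (Γ.p v) := eq_of_invariant_of_isCycleOn hg
      (F := fun v => τ' (Γ.p v)) (fun w => by
        have := hinv g (Γ.p w)
        rwa [Digraph.autAction_p] at this) v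
    have hsum : ∑ w, τ' (Γ.p w) = 1 := by
      rw [← map_sum, Digraph.sum_p]
      exact τ'.2
    rw [Finset.sum_congr rfl fun w _ => hconst w, Finset.sum_const, Finset.card_univ,
      nsmul_eq_mul] at hsum
    exact eq_one_div_of_mul_eq_one_right hsum
  exact ⟨huniq β τ' h hp', h.eq_log hrow hp'⟩
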